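/- **Lemma (Negative eigenvalues).** For measurable $V:\mathbb{R}^3\to\mathbb{R}$ put $\|V\|_{\mathcal K}:=\sup_{x\in\mathbb{R}^3}\int_{\mathbb{R}^3}\frac{|V(y)|}{|x-y|}\,dy$, and let $\mathcal{K}_0$ be the closure, in this norm, of the set of bounded compactly supported real-valued functions on $\mathbb{R}^3$. For $V\in\mathcal{K}_0$ let $\mathcal{H}=-\Delta+V$ be the operator on $L^2(\mathbb{R}^3;\mathbb{C})$ of the quadratic form $\int\nabla u\cdot\overline{\nabla v}\,dx+\int V u\overline{v}\,dx$ with form domain $H^1(\mathbb{R}^3)$; that is, $u$ is in the domain of $\mathcal{H}$ and $\mathcal{H}u=f\in L^2$ if and only if $u\in H^1$ and $\int\nabla u\cdot\overline{\nabla v}\,dx+\int Vu\overline{v}\,dx=\int f\overline{v}\,dx$ for all $v\in H^1$. For $f\in L^1(\mathbb{R}^3;\mathbb{C})$ let $(R_0(0)f)(x)=\int_{\mathbb{R}^3}\frac{f(y)}{4\pi|x-y|}\,dy$. If $V\in\mathcal{K}_0$ and zero is not a resonance of $\mathcal{H}$, i.e. $I+VR_0(0)$ is invertible in the algebra $\mathcal{L}(L^1)$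 of bounded linear operators on $L^1(\mathbb{R}^3;\mathbb{C})$, then $\mathcal{H}$ has at most finitely many negative eigenvalues, each of finite multiplicity. -/

import Mathlib

open MeasureTheory
open scoped ENNReal ContDiff InnerProductSpace

namespace SchrodingerKato

noncomputable section

/-- Euclidean three-space. -/
abbrev R3 : Type := EuclideanSpace ℝ (Fin 3)

/-- Complex `L¹(ℝ³)`. -/
abbrev L1 : Type := Lp ℂ 1 (volume : Measure R3)

/-- Complex `L²(ℝ³)`. -/
abbrev L2 : Type := Lp ℂ 2 (volume : Measure R3)

/-! ### The potential class -/

/-- The global Kato norm `sup_x ∫ |V(y)| / |x - y| dy`, with values in `[0, ∞]`.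
(The value of the integrand at the single point `y = x` is irrelevant.) -/
def globalKatoNorm (V : R3 → ℝ) : ℝ≥0∞ :=
  ⨆ x : R3, ∫⁻ y : R3, ‖V y‖ₑ / ‖x - y‖ₑ

/-- The set `C_c^b` of bounded, compactly supported (measurable) real functions. -/
def IsBoundedCompactlySupported (W : R3 → ℝ) : Prop :=
  AEMeasurable W ∧ (∃ C : ℝ, ∀ x, |W x| ≤ C) ∧ HasCompactSupport W

/-- The class `𝒦₀`: the closure of `C_c^b` in the global Kato norm. The norm of such a `V`
is finite, because bounded functions of compact support have finite norm. -/
def MemKatoZero (V : R3 → ℝ) : Prop :=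
  AEMeasurable V ∧
    ∀ ε : ℝ≥0∞, 0 < ε →
      ∃ W : R3 → ℝ, IsBoundedCompactlySupported W ∧ globalKatoNorm (V - W) < ε

/-! ### Resonances -/

/-- The kernel `e^{-√(-z) r} / (4 π r)`, `r = |x - y|`, of the free resolvent
`R₀(z) = (-Δ - z)⁻¹`. The principal branch has `Re √(-z) > 0` for `z ∉ [0, ∞)`. At `z = 0` this is
the Newton kernel `1 / (4 π r)`, and for `z > 0` it is one of the two boundary values. -/
def freeResolventKernel (z : ℂ) (x y : R3) : ℂ :=
  Complex.exp (-((-z) ^ (1 / 2 : ℂ) * (‖x - y‖ : ℂ))) / (4 * Real.pi * ‖x - y‖ : ℝ)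

/-- The free resolvent `(R₀(z) f)(x) = ∫ e^{-√(-z)|x-y|} / (4π|x-y|) f(y) dy`. -/
def freeResolvent (z : ℂ) (f : R3 → ℂ) (x : R3) : ℂ :=
  ∫ y : R3, freeResolventKernel z x y * f y

/-- `I + V R₀(z)` is (given by) an invertible element of the algebra of bounded linear operators
on `L¹`. -/
def IsInvertibleOnL1 (V : R3 → ℝ) (z : ℂ) : Prop :=
  ∃ A : L1 →L[ℂ] L1,
    (∀ f : L1, ∀ᵐ x : R3, A f x = f x + (V x : ℂ) * freeResolvent z f x) ∧ IsUnit A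

/-- `z` is a resonance of `-Δ + V` if `I + V R₀(z)` is not invertible on `L¹`. -/
def IsResonance (V : R3 → ℝ) (z : ℂ) : Prop :=
  ¬ IsInvertibleOnL1 V z

/-! ### The Sobolev space `H¹` through weak derivatives -/

/-- `G = (G₀, G₁, G₂) ∈ (L²)³` is the weak gradient of `u ∈ L²`. So `u ∈ H¹` if and only if
`u` has such a `G`. -/
def HasWeakGradient (u : L2) (G : Fin 3 → L2) : Prop :=
  ∀ i : Fin 3, ∀ φ : R3 → ℝ, ContDiff ℝ ∞ φ → HasCompactSupport φ →
    ∫ x, fderiv ℝ φ x (EuclideanSpace.single i 1) • u x = - ∫ x, φ x • G i x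

lemma integrable_smul_L2 {φ : R3 → ℝ} (hφ : Continuous φ) (hs : HasCompactSupport φ) (u : L2) :
    Integrable (fun x => φ x • u x) := by
  have h := (Lp.memLp u).locallyIntegrable (by norm_num)
  exact h.integrable_smul_left_of_hasCompactSupport hφ hs

lemma continuous_fderiv_apply' {φ : R3 → ℝ} (hφ : ContDiff ℝ ∞ φ) (v : R3) :
    Continuous fun x => fderiv ℝ φ x v :=
  (hφ.continuous_fderiv (by simp)).clm_apply continuous_const

lemma HasWeakGradient.add {u v : L2} {G K : Fin 3 → L2}
    (hu : HasWeakGradient u G) (hv : HasWeakGradient v K) : HasWeakGradient (u + v) (G + K) := by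
  intro i φ hφ hs
  have hs' := hs.fderiv_apply (𝕜 := ℝ) (EuclideanSpace.single i (1 : ℝ))
  have hc' := continuous_fderiv_apply' hφ (EuclideanSpace.single i (1 : ℝ))
  have e1 : ∫ x, fderiv ℝ φ x (EuclideanSpace.single i 1) • (u + v : L2) x
      = ∫ x, (fderiv ℝ φ x (EuclideanSpace.single i 1) • u x
        + fderiv ℝ φ x (EuclideanSpace.single i 1) • v x) := by
    apply integral_congr_ae
    filter_upwards [Lp.coeFn_add u v] with x hx
    rw [hx, Pi.add_apply, smul_add]
  have e2 : ∫ x, φ x • ((G + K) i : L2) x = ∫ x, (φ x • G i x + φ x • K i x) := by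
    apply integral_congr_ae
    filter_upwards [Lp.coeFn_add (G i) (K i)] with x hx
    rw [Pi.add_apply, hx, Pi.add_apply, smul_add]
  rw [e1, e2, integral_add (integrable_smul_L2 hc' hs' u) (integrable_smul_L2 hc' hs' v),
    integral_add (integrable_smul_L2 hφ.continuous hs _) (integrable_smul_L2 hφ.continuous hs _),
    hu i φ hφ hs, hv i φ hφ hs]
  ring

lemma HasWeakGradient.smul {u : L2} {G : Fin 3 → L2} (c : ℂ)
    (hu : HasWeakGradient u G) : HasWeakGradient (c • u) (c • G) := by
  intro i φ hφ hs
  have e1 : ∫ x, fderiv ℝ φ x (EuclideanSpace.single i 1) • (c • u : L2) x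
      = ∫ x, c • (fderiv ℝ φ x (EuclideanSpace.single i 1) • u x) := by
    apply integral_congr_ae
    filter_upwards [Lp.coeFn_smul c u] with x hx
    rw [hx, Pi.smul_apply, smul_comm]
  have e2 : ∫ x, φ x • ((c • G) i : L2) x = ∫ x, c • (φ x • G i x) := by
    apply integral_congr_ae
    filter_upwards [Lp.coeFn_smul c (G i)] with x hx
    rw [Pi.smul_apply, hx, Pi.smul_apply, smul_comm]
  rw [e1, e2, integral_smul, integral_smul, hu i φ hφ hs, smul_neg]

lemma HasWeakGradient.zero : HasWeakGradient 0 0 := by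
  simpa using (HasWeakGradient.smul (0 : ℂ) (u := 0) (G := 0) (by
    intro i φ hφ hs
    have e : ∀ g : R3 → ℝ, ∫ x, g x • (0 : L2) x = 0 := by
      intro g
      refine integral_eq_zero_of_ae ?_
      filter_upwards with x
      simp
    rw [e]
    simp only [Pi.zero_apply]
    rw [e, neg_zero]))

/-- An element of `L²` that is orthogonal to all test functions vanishes. -/
lemma eq_zero_of_test {f : L2}
    (h : ∀ φ : R3 → ℝ, ContDiff ℝ ∞ φ → HasCompactSupport φ → ∫ x, φ x • f x = 0) : f = 0 := by
  have h1 := ae_eq_zero_of_integral_contDiff_smul_eq_zero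
    ((Lp.memLp f).locallyIntegrable (by norm_num)) h
  exact Lp.eq_zero_iff_ae_eq_zero.mpr h1

lemma HasWeakGradient.eq_zero {G : Fin 3 → L2} (h : HasWeakGradient 0 G) : G = 0 := by
  funext i
  refine eq_zero_of_test fun φ hφ hs => ?_
  have h1 := h i φ hφ hs
  have h2 := HasWeakGradient.zero i φ hφ hs
  rw [h1] at h2
  rw [neg_inj] at h2
  rw [h2]
  refine integral_eq_zero_of_ae ?_
  filter_upwards with x
  simp

/-! ### The Schrödinger operator -/

/-- `H u = f` in the sense of the quadratic form `q` of `-Δ + V` with form domain `H¹`: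
`u ∈ H¹`, and `∫ ∇u · conj ∇v + ∫ V u conj v = ∫ f conj v` for all `v ∈ H¹`
(`⟪v, f⟫_ℂ` is `∫ f conj v`). -/
def SchrodingerEq (V : R3 → ℝ) (u f : L2) : Prop :=
  ∃ G : Fin 3 → L2, HasWeakGradient u G ∧
    ∀ (v : L2) (K : Fin 3 → L2), HasWeakGradient v K →
      Integrable (fun x : R3 => (V x : ℂ) * u x * starRingEnd ℂ (v x)) ∧
      ∑ i, ⟪K i, G i⟫_ℂ + ∫ x : R3, (V x : ℂ) * u x * starRingEnd ℂ (v x) = ⟪v, f⟫_ℂ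

/-- The graph of the Schrödinger operator, `{(u, f) | H u = f}`. -/
def schrodingerGraph (V : R3 → ℝ) : Submodule ℂ (L2 × L2) where
  carrier := {p | SchrodingerEq V p.1 p.2}
  zero_mem' := by
    refine ⟨0, HasWeakGradient.zero, fun v K _ => ?_⟩
    have e : (fun x : R3 => (V x : ℂ) * (0 : L2) x * starRingEnd ℂ (v x)) =ᵐ[volume] 0 := by
      filter_upwards with x
      simp
    refine ⟨(integrable_congr e).mpr (integrable_zero _ _ _), ?_⟩
    simp only [Prod.fst_zero, Prod.snd_zero]
    rw [integral_eq_zero_of_ae e]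
    simp
  add_mem' := by
    rintro ⟨u, f⟩ ⟨u', f'⟩ ⟨G, hG, h⟩ ⟨G', hG', h'⟩
    refine ⟨G + G', hG.add hG', fun v K hK => ?_⟩
    obtain ⟨i1, e1⟩ := h v K hK
    obtain ⟨i2, e2⟩ := h' v K hK
    simp only [Prod.mk_add_mk] at *
    have e : (fun x : R3 => (V x : ℂ) * (u + u' : L2) x * starRingEnd ℂ (v x)) =ᵐ[volume]
        fun x => (V x : ℂ) * u x * starRingEnd ℂ (v x)
          + (V x : ℂ) * u' x * starRingEnd ℂ (v x) := by
      filter_upwards [Lp.coeFn_add u u'] with x hx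
      rw [hx, Pi.add_apply]
      ring
    refine ⟨(integrable_congr e).mpr (i1.add i2), ?_⟩
    rw [integral_congr_ae e, integral_add i1 i2, inner_add_right, ← e1, ← e2]
    simp only [Pi.add_apply, inner_add_right, Finset.sum_add_distrib]
    ring
  smul_mem' := by
    rintro c ⟨u, f⟩ ⟨G, hG, h⟩
    refine ⟨c • G, hG.smul c, fun v K hK => ?_⟩
    obtain ⟨i1, e1⟩ := h v K hK
    simp only [Prod.smul_mk] at *
    have e : (fun x : R3 => (V x : ℂ) * (c • u : L2) x * starRingEnd ℂ (v x)) =ᵐ[volume]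
        fun x => c * ((V x : ℂ) * u x * starRingEnd ℂ (v x)) := by
      filter_upwards [Lp.coeFn_smul c u] with x hx
      rw [hx, Pi.smul_apply, smul_eq_mul]
      ring
    refine ⟨(integrable_congr e).mpr (i1.const_mul c), ?_⟩
    rw [integral_congr_ae e, integral_const_mul, inner_smul_right, ← e1]
    simp only [Pi.smul_apply, inner_smul_right, ← Finset.mul_sum]
    ring

/-- A real test function, as an element of `L²`, with its gradient. -/
lemma exists_test_L2 {φ : R3 → ℝ} (hφ : ContDiff ℝ ∞ φ) (hs : HasCompactSupport φ) :
    ∃ (v : L2) (K : Fin 3 → L2), HasWeakGradient v K ∧ ∀ᵐ x, v x = (φ x : ℂ) := by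
  have mem : ∀ g : R3 → ℝ, Continuous g → HasCompactSupport g →
      MemLp (fun x => (g x : ℂ)) 2 (volume : Measure R3) := fun g hg hgs =>
    (hg.memLp_of_hasCompactSupport hgs).ofReal
  have hc' := fun i : Fin 3 => continuous_fderiv_apply' hφ (EuclideanSpace.single i (1 : ℝ))
  have hs' := fun i : Fin 3 => hs.fderiv_apply (𝕜 := ℝ) (EuclideanSpace.single i (1 : ℝ))
  refine ⟨(mem φ hφ.continuous hs).toLp, fun i => (mem _ (hc' i) (hs' i)).toLp, ?_,
    MemLp.coeFn_toLp _⟩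
  intro i η hη hηs
  have hcη := continuous_fderiv_apply' hη (EuclideanSpace.single i (1 : ℝ))
  have e1 : ∫ x, fderiv ℝ η x (EuclideanSpace.single i 1) • ((mem φ hφ.continuous hs).toLp : L2) x
      = ∫ x, ((φ x * fderiv ℝ η x (EuclideanSpace.single i 1) : ℝ) : ℂ) := by
    apply integral_congr_ae
    filter_upwards [MemLp.coeFn_toLp (mem φ hφ.continuous hs)] with x hx
    rw [hx, Complex.real_smul]
    push_cast
    ring
  have e2 : ∫ x, η x • ((mem _ (hc' i) (hs' i)).toLp : L2) x
      = ∫ x, ((fderiv ℝ φ x (EuclideanSpace.single i 1) * η x : ℝ) : ℂ) := by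
    apply integral_congr_ae
    filter_upwards [MemLp.coeFn_toLp (mem _ (hc' i) (hs' i))] with x hx
    rw [hx, Complex.real_smul]
    push_cast
    ring
  rw [e1, e2, integral_complex_ofReal, integral_complex_ofReal,
    integral_mul_fderiv_eq_neg_fderiv_mul_of_integrable
      (((hc' i).mul hη.continuous).integrable_of_hasCompactSupport (hηs.mul_left))
      ((hφ.continuous.mul hcη).integrable_of_hasCompactSupport (hs.mul_right))
      ((hφ.continuous.mul hη.continuous).integrable_of_hasCompactSupport (hs.mul_right))
      (fun x _ => hφ.differentiable (by simp) x) (fun x _ => hη.differentiable (by simp) x)]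
  push_cast
  rfl

/-- The graph is single-valued, so that the operator below is well defined. -/
lemma schrodingerGraph_singleValued (V : R3 → ℝ) :
    ∀ p ∈ schrodingerGraph V, p.1 = 0 → p.2 = 0 := by
  rintro ⟨u, f⟩ ⟨G, hG, h⟩ hu
  simp only at hG h hu ⊢
  subst hu
  obtain rfl := hG.eq_zero
  refine eq_zero_of_test fun φ hφ hs => ?_
  obtain ⟨v, K, hK, hv⟩ := exists_test_L2 hφ hs
  obtain ⟨-, e⟩ := h v K hK
  have e0 : (fun x : R3 => (V x : ℂ) * (0 : L2) x * starRingEnd ℂ (v x)) =ᵐ[volume] 0 := by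
    filter_upwards with x
    simp
  rw [integral_eq_zero_of_ae e0] at e
  simp only [Pi.zero_apply, inner_zero_right, Finset.sum_const_zero, add_zero] at e
  rw [L2.inner_def] at e
  rw [e]
  apply integral_congr_ae
  filter_upwards [hv] with x hx
  simp [hx, mul_comm]

/-- The Schrödinger operator `H = -Δ + V` on `L²`, with domain
`{u ∈ H¹ | (-Δ + V) u ∈ L²}`: the operator of the quadratic form `q`. -/
def schrodingerOperator (V : R3 → ℝ) : L2 →ₗ.[ℂ] L2 :=
  (schrodingerGraph V).toLinearPMap

/-- `H u = f` means what it should. -/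
lemma mem_graph_schrodingerOperator (V : R3 → ℝ) (u f : L2) :
    (u, f) ∈ (schrodingerOperator V).graph ↔ SchrodingerEq V u f := by
  rw [schrodingerOperator,
    Submodule.toLinearPMap_graph_eq _ (schrodingerGraph_singleValued V)]
  rfl

/-- The eigenspace `{ψ ∈ D(T) | T ψ = μ ψ}` of a partially defined operator `T`. -/
def eigenspace (T : L2 →ₗ.[ℂ] L2) (μ : ℂ) : Submodule ℂ T.domain :=
  LinearMap.ker (T.toFun - μ • T.domain.subtype)

/-- `μ` is an eigenvalue of `T` if its eigenspace is not zero. -/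
def IsEigenvalue (T : L2 →ₗ.[ℂ] L2) (μ : ℂ) : Prop :=
  eigenspace T μ ≠ ⊥

end

end SchrodingerKato

/-!
Everything rests on a form bound: `∫ |V| |u|² ≤ ∫ |∇u|²` for all `u ∈ H¹` whose mean vanishes on
each of finitely many cells `Q`. Approximate `V` in the Kato norm by a bounded `W` of compact
support.

For `V - W` use Kato's inequality `∫ |U| |u|² ≤ C ‖U‖_𝒦 ∫ |∇u|²`. Averaging the fundamental theorem
of calculus over all rays from `x` bounds `|u x|` by the integral of `|∇u y| / |x - y|²`, up to a
constant; by Schur's test it suffices that `∫ |x - y|⁻² |x' - y|⁻² dy ≤ C / |x - x'|`.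

For `W` use Poincaré's inequality on cells of small diameter covering the support of `W`.

The form of `-Δ + V` is therefore nonnegative on the functions with vanishing cell integrals, while
it is negative on nonzero sums of eigenfunctions with negative eigenvalues, by orthogonality. So the
map `u ↦ (∫_Q u)_Q` into a finite-dimensional space is injective on the span of these.
-/

namespace SchrodingerKato

open Filter Topology Set Module

section Schur

variable {α β : Type*} [MeasurableSpace α] [MeasurableSpace β]

theorem sq_lintegral_le_of_sq_le_mul {μ : Measure α} {f a b : α → ℝ≥0∞} (ha : AEMeasurable a μ)
    (hb : AEMeasurable b μ) (h : ∀ᵐ x ∂μ, f x ^ 2 ≤ a x * b x) :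
    (∫⁻ x, f x ∂μ) ^ 2 ≤ (∫⁻ x, a x ∂μ) * ∫⁻ x, b x ∂μ := by
  have sq_rpow_half (t : ℝ≥0∞) : (t ^ (1 / 2 : ℝ)) ^ 2 = t := by
    rw [← ENNReal.rpow_two, ← ENNReal.rpow_mul]
    norm_num
  calc (∫⁻ x, f x ∂μ) ^ 2 ≤ (∫⁻ x, a x ^ (1 / 2 : ℝ) * b x ^ (1 / 2 : ℝ) ∂μ) ^ 2 := by
        gcongr ?_ ^ 2
        refine lintegral_mono_ae (h.mono fun x hx => ?_)
        refine (ENNReal.pow_le_pow_left_iff two_ne_zero).mp ?_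
        rwa [mul_pow, sq_rpow_half, sq_rpow_half]
    _ ≤ ((∫⁻ x, a x ∂μ) ^ (1 / 2 : ℝ) * (∫⁻ x, b x ∂μ) ^ (1 / 2 : ℝ)) ^ 2 := by
        gcongr
        exact ENNReal.lintegral_mul_norm_pow_le ha hb (by norm_num) (by norm_num) (by norm_num)
    _ = (∫⁻ x, a x ∂μ) * ∫⁻ x, b x ∂μ := by rw [mul_pow, sq_rpow_half, sq_rpow_half]

theorem sq_lintegral_mul_le {μ : Measure α} {f g : α → ℝ≥0∞} (hf : AEMeasurable f μ)
    (hg : AEMeasurable g μ) :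
    (∫⁻ x, f x * g x ∂μ) ^ 2 ≤ (∫⁻ x, f x ^ 2 ∂μ) * ∫⁻ x, g x ^ 2 ∂μ :=
  sq_lintegral_le_of_sq_le_mul (hf.pow_const 2) (hg.pow_const 2)
    (.of_forall fun _ => (mul_pow _ _ _).le)

theorem lintegral_sq_lintegral_mul_le {μ : Measure α} {ν : Measure β} [SFinite μ] [SFinite ν]
    {k : α → β → ℝ≥0∞} (hk : Measurable (Function.uncurry k)) {f : β → ℝ≥0∞} (hf : Measurable f)
    {M : ℝ≥0∞} (hM : M ≠ ⊤) (h : ∀ x, ∫⁻ y, k x y * ∫⁻ x', k x' y ∂μ ∂ν ≤ M) :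
    ∫⁻ x, (∫⁻ y, k x y * f y ∂ν) ^ 2 ∂μ ≤ M * ∫⁻ y, f y ^ 2 ∂ν := by
  set g : β → ℝ≥0∞ := fun y => ∫⁻ x', k x' y ∂μ
  have hg : Measurable g := hk.lintegral_prod_left'
  have hkx (x : α) : Measurable (k x) := hk.of_uncurry_left
  have ae_zero : ∀ᵐ x ∂μ, ∀ᵐ y ∂ν, g y = 0 → k x y = 0 := by
    refine (Measure.ae_ae_comm ?_).mpr (.of_forall fun y => ?_)
    · exact (measurableSet_eq_fun (hg.comp measurable_snd) measurable_const).imp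
        (measurableSet_eq_fun hk measurable_const)
    · by_cases hy : g y = 0
      · filter_upwards [(lintegral_eq_zero_iff hk.of_uncurry_right).mp hy] with x hx _ using hx
      · exact .of_forall fun x hx => absurd hx hy
  have cauchy_schwarz : ∀ᵐ x ∂μ,
      (∫⁻ y, k x y * f y ∂ν) ^ 2 ≤ M * ∫⁻ y, k x y * (f y ^ 2 / g y) ∂ν := by
    filter_upwards [ae_zero] with x hx
    refine (sq_lintegral_le_of_sq_le_mul ((hkx x).mul hg).aemeasurable
      ((hkx x).mul ((hf.pow_const 2).div hg)).aemeasurable ?_).trans (mul_le_mul_left (h x) _)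
    filter_upwards [hx, ae_lt_top ((hkx x).mul hg) ((h x).trans_lt hM.lt_top).ne] with y hy hfin
    rcases eq_or_ne (k x y) 0 with h0 | h0
    · simp [h0]
    have hgy0 : g y ≠ 0 := fun hg0 => h0 (hy hg0)
    have hgy : g y ≠ ⊤ := fun htop => by simp [htop, ENNReal.mul_top h0] at hfin
    calc (k x y * f y) ^ 2 = k x y * (k x y * (g y * (f y ^ 2 / g y))) := by
          rw [ENNReal.mul_div_cancel hgy0 hgy]; ring
      _ ≤ k x y * g y * (k x y * (f y ^ 2 / g y)) := by ring_nf; rfl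
  calc ∫⁻ x, (∫⁻ y, k x y * f y ∂ν) ^ 2 ∂μ
      ≤ ∫⁻ x, M * ∫⁻ y, k x y * (f y ^ 2 / g y) ∂ν ∂μ := lintegral_mono_ae cauchy_schwarz
    _ = M * ∫⁻ y, g y * (f y ^ 2 / g y) ∂ν := by
      rw [lintegral_const_mul' _ _ hM, lintegral_lintegral_swap
        (hk.mul (((hf.pow_const 2).div hg).comp measurable_snd)).aemeasurable]
      congr 1
      exact lintegral_congr fun y => lintegral_mul_const _ hk.of_uncurry_right
    _ ≤ M * ∫⁻ y, f y ^ 2 ∂ν := by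
      gcongr
      exact ENNReal.mul_div_le

end Schur

section Riesz

variable {E F : Type*} [NormedAddCommGroup E] [NormedAddCommGroup F] [NormedSpace ℝ F]

/-- The Riesz kernel `|x - y|⁻ᵖ`, with the value `∞` on the diagonal if `p ≠ 0`. In dimension three,
`p = 1` is the Newton kernel and `p = 2` bounds a function by its gradient. -/
noncomputable def rieszKernel (p : ℕ) (x y : E) : ℝ≥0∞ :=
  (‖x - y‖ₑ⁻¹) ^ p

theorem measurable_rieszKernel [MeasurableSpace E] [BorelSpace E] [SecondCountableTopology E]
    (p : ℕ) : Measurable (Function.uncurry (rieszKernel p : E → E → ℝ≥0∞)) := by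
  unfold rieszKernel Function.uncurry
  fun_prop

variable [NormedSpace ℝ E]

theorem enorm_le_lintegral_ray {u : E → F} (hu : ContDiff ℝ 1 u) (hs : HasCompactSupport u)
    (x : E) {v : E} (hv : v ≠ 0) :
    ‖u x‖ₑ ≤ ∫⁻ r in Ioi (0 : ℝ), ‖fderiv ℝ u (x - r • v)‖ₑ * ‖v‖ₑ := by
  have hderiv (t : ℝ) : deriv (fun t : ℝ => u (x + t • v)) t = fderiv ℝ u (x + t • v) v := by
    have hline : HasDerivAt (fun t : ℝ => x + t • v) v t := by
      simpa using ((hasDerivAt_id t).smul_const v).const_add x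
    exact ((hu.differentiable one_ne_zero _).hasFDerivAt.comp_hasDerivAt t hline).deriv
  have hsupp : HasCompactSupport fun t : ℝ => u (x + t • v) :=
    hs.comp_isClosedEmbedding
      ((Homeomorph.addLeft x).isClosedEmbedding.comp (isClosedEmbedding_smul_left hv))
  calc ‖u x‖ₑ = ‖u (x + (0 : ℝ) • v)‖ₑ := by simp
    _ ≤ ∫⁻ t in Iic (0 : ℝ), ‖deriv (fun t : ℝ => u (x + t • v)) t‖ₑ :=
      hsupp.enorm_le_lintegral_Ici_deriv (hu.comp (f := fun t : ℝ => x + t • v) (by fun_prop)) 0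
    _ ≤ ∫⁻ t in Iic (0 : ℝ), ‖fderiv ℝ u (x + t • v)‖ₑ * ‖v‖ₑ :=
      lintegral_mono fun t => by rw [hderiv]; exact ContinuousLinearMap.le_opENorm _ _
    _ = ∫⁻ r in Ici (0 : ℝ), ‖fderiv ℝ u (x - r • v)‖ₑ * ‖v‖ₑ := by
      rw [← (Measure.measurePreserving_neg (volume : Measure ℝ)).setLIntegral_comp_preimage_emb
        (Homeomorph.neg ℝ).measurableEmbedding]
      simp [sub_eq_add_neg]
    _ = _ := by rw [restrict_Ioi_eq_restrict_Ici]

variable [FiniteDimensional ℝ E] [Nontrivial E] [MeasurableSpace E] [BorelSpace E]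
  (μ : Measure E) [μ.IsAddHaarMeasure]

theorem lintegral_eq_lintegral_toSphere {f : E → ℝ≥0∞} (hf : Measurable f) :
    ∫⁻ x, f x ∂μ = ∫⁻ θ, (∫⁻ r in Ioi (0 : ℝ),
      ENNReal.ofReal (r ^ (finrank ℝ E - 1)) * f (r • (θ : E))) ∂μ.toSphere := by
  have hpolar := μ.measurePreserving_homeomorphUnitSphereProd.symm
    (homeomorphUnitSphereProd E).toMeasurableEquiv
  calc ∫⁻ x, f x ∂μ = ∫⁻ x in {0}ᶜ, f x ∂μ := by rw [restrict_compl_singleton]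
    _ = ∫⁻ x : ({0}ᶜ : Set E), f x ∂(μ.comap (↑)) :=
      (lintegral_subtype_comap (measurableSet_singleton 0).compl f).symm
    _ = ∫⁻ p, f ((homeomorphUnitSphereProd E).symm p)
          ∂(μ.toSphere.prod (Measure.volumeIoiPow (finrank ℝ E - 1))) :=
      (hpolar.lintegral_comp (hf.comp measurable_subtype_coe)).symm
    _ = ∫⁻ θ, (∫⁻ r, f ((r : ℝ) • (θ : E)) ∂(Measure.volumeIoiPow (finrank ℝ E - 1)))
          ∂μ.toSphere :=
      lintegral_prod _ (hf.comp (measurable_subtype_coe.comp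
        (homeomorphUnitSphereProd E).symm.measurable)).aemeasurable
    _ = _ := by
      refine lintegral_congr fun θ => ?_
      rw [Measure.volumeIoiPow, lintegral_withDensity_eq_lintegral_mul _ (by fun_prop)
        (show Measurable fun r : Ioi (0 : ℝ) => f ((r : ℝ) • (θ : E)) from hf.comp (by fun_prop))]
      exact lintegral_subtype_comap measurableSet_Ioi
        fun r : ℝ => ENNReal.ofReal (r ^ (finrank ℝ E - 1)) * f (r • (θ : E))

omit [FiniteDimensional ℝ E] [Nontrivial E] [MeasurableSpace E] [BorelSpace E] in
theorem enorm_smul_coe_sphere {r : ℝ} (hr : 0 < r) (θ : Metric.sphere (0 : E) 1) :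
    ‖r • (θ : E)‖ₑ = ENNReal.ofReal r := by
  rw [← ofReal_norm, norm_smul, norm_eq_of_mem_sphere, mul_one, Real.norm_of_nonneg hr.le]

theorem lintegral_enorm_inv_pow_mul {f : E → ℝ≥0∞} (hf : Measurable f) :
    ∫⁻ x, (‖x‖ₑ⁻¹) ^ (finrank ℝ E - 1) * f x ∂μ =
      ∫⁻ θ, (∫⁻ r in Ioi (0 : ℝ), f (r • (θ : E))) ∂μ.toSphere := by
  rw [lintegral_eq_lintegral_toSphere μ (by fun_prop)]
  refine lintegral_congr fun θ => setLIntegral_congr_fun measurableSet_Ioi fun r hr => ?_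
  have hr : 0 < r := hr
  rw [enorm_smul_coe_sphere hr, ← mul_assoc, ENNReal.ofReal_pow hr.le, ← mul_pow,
    ENNReal.mul_inv_cancel (by simpa) ENNReal.ofReal_ne_top, one_pow, one_mul]

theorem enorm_le_lintegral_rieszKernel_fderiv {u : E → F} (hu : ContDiff ℝ 1 u)
    (hs : HasCompactSupport u) (x : E) :
    ‖u x‖ₑ ≤ (μ.toSphere univ)⁻¹ *
      ∫⁻ y, rieszKernel (finrank ℝ E - 1) x y * ‖fderiv ℝ u y‖ₑ ∂μ := by
  have hDu : Measurable fun y => ‖fderiv ℝ u y‖ₑ :=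
    (hu.continuous_fderiv one_ne_zero).enorm.measurable
  rw [mul_comm, ← div_eq_mul_inv, ENNReal.le_div_iff_mul_le
    (.inl (Measure.measure_univ_ne_zero.mpr μ.toSphere_ne_zero)) (.inl (measure_ne_top _ _)),
    ← lintegral_const]
  calc ∫⁻ _, ‖u x‖ₑ ∂μ.toSphere
      ≤ ∫⁻ θ, (∫⁻ r in Ioi (0 : ℝ), ‖fderiv ℝ u (x - r • (θ : E))‖ₑ) ∂μ.toSphere := by
        refine lintegral_mono fun θ => ?_
        refine (enorm_le_lintegral_ray hu hs x (ne_zero_of_mem_unit_sphere θ)).trans_eq ?_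
        simp [← ofReal_norm (θ : E)]
    _ = ∫⁻ z, (‖z‖ₑ⁻¹) ^ (finrank ℝ E - 1) * ‖fderiv ℝ u (x - z)‖ₑ ∂μ :=
      (lintegral_enorm_inv_pow_mul μ (hDu.comp (measurable_const.sub measurable_id))).symm
    _ = _ := by
      rw [← lintegral_sub_left_eq_self _ x]
      simp [rieszKernel]

theorem lintegral_Ioi_inv_max_pow_le {s : ℝ} (hs : 0 < s) (n : ℕ) :
    ∫⁻ r in Ioi (0 : ℝ), ((max (ENNReal.ofReal s) (ENNReal.ofReal r))⁻¹) ^ (n + 2) ≤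
      2 * ((ENNReal.ofReal s)⁻¹) ^ (n + 1) := by
  have hnear : ∫⁻ r in Ioc 0 s, ((max (ENNReal.ofReal s) (ENNReal.ofReal r))⁻¹) ^ (n + 2) =
      ((ENNReal.ofReal s)⁻¹) ^ (n + 1) := by
    rw [setLIntegral_congr_fun (g := fun _ => ((ENNReal.ofReal s)⁻¹) ^ (n + 2)) measurableSet_Ioc
      fun r hr => by simp only [max_eq_left (ENNReal.ofReal_le_ofReal hr.2)],
      setLIntegral_const, Real.volume_Ioc, sub_zero, pow_succ, mul_assoc,
      ENNReal.inv_mul_cancel (by simpa) ENNReal.ofReal_ne_top, mul_one]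
  have hfar : ∫⁻ r in Ioi s, ((max (ENNReal.ofReal s) (ENNReal.ofReal r))⁻¹) ^ (n + 2) ≤
      ((ENNReal.ofReal s)⁻¹) ^ (n + 1) := by
    have hexp : -((n : ℝ) + 2) < -1 := by linarith [(n.cast_nonneg : (0 : ℝ) ≤ n)]
    calc ∫⁻ r in Ioi s, ((max (ENNReal.ofReal s) (ENNReal.ofReal r))⁻¹) ^ (n + 2)
        = ∫⁻ r in Ioi s, ENNReal.ofReal (r ^ (-((n : ℝ) + 2))) := by
          refine setLIntegral_congr_fun measurableSet_Ioi fun r hr => ?_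
          have hsr : s < r := hr
          have hr0 : 0 < r := hs.trans hsr
          rw [max_eq_right (ENNReal.ofReal_le_ofReal hsr.le), ← ENNReal.ofReal_inv_of_pos hr0,
            ← ENNReal.ofReal_pow (by positivity), Real.rpow_neg hr0.le, inv_pow]
          norm_cast
      _ = ENNReal.ofReal (∫ r in Ioi s, r ^ (-((n : ℝ) + 2))) := by
          refine (ofReal_integral_eq_lintegral_ofReal (integrableOn_Ioi_rpow_of_lt hexp hs)
            ?_).symm
          filter_upwards [ae_restrict_mem measurableSet_Ioi] with r hr
          exact Real.rpow_nonneg (hs.trans hr).le _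
      _ ≤ ENNReal.ofReal ((s⁻¹) ^ (n + 1)) := by
          refine ENNReal.ofReal_le_ofReal ?_
          rw [integral_Ioi_rpow_of_lt hexp hs, show -((n : ℝ) + 2) + 1 = -((n + 1 : ℕ) : ℝ) by
            push_cast; ring, Real.rpow_neg hs.le, Real.rpow_natCast, neg_div_neg_eq, inv_pow]
          exact div_le_self (by positivity) (by simp)
      _ = _ := by rw [ENNReal.ofReal_pow (by positivity), ENNReal.ofReal_inv_of_pos hs]
  rw [← Ioc_union_Ioi_eq_Ioi hs.le, lintegral_union measurableSet_Ioi
    (disjoint_left.mpr fun r hr hr' => not_lt_of_ge hr.2 hr'), two_mul, hnear]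
  gcongr

theorem lintegral_truncated_rieszKernel_le (hd : 2 < finrank ℝ E) {s : ℝ} (hs : 0 < s) :
    ∫⁻ z, (‖z‖ₑ⁻¹) ^ (finrank ℝ E - 1) *
        ((max (ENNReal.ofReal s) ‖z‖ₑ)⁻¹) ^ (finrank ℝ E - 1) ∂μ ≤
      2 * μ.toSphere univ * ((ENNReal.ofReal s)⁻¹) ^ (finrank ℝ E - 2) := by
  obtain ⟨n, hn⟩ : ∃ n, finrank ℝ E = n + 3 := ⟨finrank ℝ E - 3, by omega⟩
  rw [lintegral_enorm_inv_pow_mul μ (by fun_prop)]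
  calc _ ≤ ∫⁻ _, 2 * ((ENNReal.ofReal s)⁻¹) ^ (finrank ℝ E - 2) ∂μ.toSphere := by
        refine lintegral_mono fun θ => ?_
        rw [hn]
        refine Eq.trans_le ?_ (lintegral_Ioi_inv_max_pow_le hs n)
        refine setLIntegral_congr_fun measurableSet_Ioi fun r hr => ?_
        rw [enorm_smul_coe_sphere hr]
        rfl
    _ = _ := by rw [lintegral_const]; ring

theorem lintegral_rieszKernel_mul_rieszKernel_le (hd : 2 < finrank ℝ E) (x y : E) :
    ∫⁻ z, rieszKernel (finrank ℝ E - 1) x z * rieszKernel (finrank ℝ E - 1) y z ∂μ ≤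
      2 ^ finrank ℝ E * μ.toSphere univ * rieszKernel (finrank ℝ E - 2) x y := by
  obtain rfl | hxy := eq_or_ne x y
  · simp [rieszKernel, ENNReal.mul_top, Nat.sub_eq_zero_iff_le, hd,
      Measure.measure_univ_ne_zero.mpr μ.toSphere_ne_zero, - Measure.toSphere_apply_univ]
  set m := finrank ℝ E - 1
  set s := ‖x - y‖ / 2
  have hs : 0 < s := half_pos (norm_sub_pos_iff.mpr hxy)
  have hs_enorm : ENNReal.ofReal s = ‖x - y‖ₑ / 2 := by
    rw [ENNReal.ofReal_div_of_pos two_pos, ofReal_norm, ENNReal.ofReal_ofNat]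
  set κ : E → ℝ≥0∞ := fun v => (‖v‖ₑ⁻¹) ^ m * ((max (ENNReal.ofReal s) ‖v‖ₑ)⁻¹) ^ m
  -- The factor with the larger denominator is bounded by its value at distance `max s |·|`.
  have hnear {a b : E} (hab : ‖a - b‖ₑ = ‖x - y‖ₑ) {z : E} (h : ‖a - z‖ₑ ≤ ‖b - z‖ₑ) :
      rieszKernel m a z * rieszKernel m b z ≤ κ (a - z) := by
    have htri : ‖x - y‖ₑ ≤ ‖a - z‖ₑ + ‖b - z‖ₑ := by
      simpa only [← edist_eq_enorm_sub, ← hab] using edist_triangle_right a b z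
    dsimp only [rieszKernel, κ]
    gcongr
    refine max_le ?_ h
    rw [hs_enorm]
    refine ENNReal.div_le_of_le_mul (htri.trans ?_)
    rw [mul_two]
    gcongr
  have hpt (z : E) : rieszKernel m x z * rieszKernel m y z ≤ κ (x - z) + κ (y - z) := by
    rcases le_total ‖x - z‖ₑ ‖y - z‖ₑ with h | h
    · exact (hnear rfl h).trans le_self_add
    · rw [mul_comm]
      exact (hnear (enorm_sub_rev y x) h).trans le_add_self
  have hκ : Measurable κ := by fun_prop
  calc _ ≤ ∫⁻ z, κ (x - z) + κ (y - z) ∂μ := lintegral_mono hpt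
    _ = 2 * ∫⁻ z, κ z ∂μ := by
      rw [lintegral_add_left (by fun_prop), lintegral_sub_left_eq_self,
        lintegral_sub_left_eq_self, two_mul]
    _ ≤ 2 * (2 * μ.toSphere univ * ((ENNReal.ofReal s)⁻¹) ^ (finrank ℝ E - 2)) := by
      gcongr
      exact lintegral_truncated_rieszKernel_le μ hd hs
    _ = 2 ^ (finrank ℝ E - 2 + 2) * μ.toSphere univ * rieszKernel (finrank ℝ E - 2) x y := by
      rw [hs_enorm, ENNReal.inv_div (by simp) (by simp), div_eq_mul_inv, mul_pow, rieszKernel,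
        pow_add]
      ring
    _ = _ := by rw [Nat.sub_add_cancel hd.le]

end Riesz

section Kato

variable {E F : Type*} [NormedAddCommGroup E] [NormedSpace ℝ E] [FiniteDimensional ℝ E]
  [MeasurableSpace E] [BorelSpace E] [NormedAddCommGroup F] [NormedSpace ℝ F]
  (μ : Measure E) [μ.IsAddHaarMeasure] {ν : Measure E} [SFinite ν]

theorem lintegral_sq_enorm_le_of_contDiff (hd : 2 < finrank ℝ E) {K : ℝ≥0∞} (hK : K ≠ ⊤)
    (hν : ∀ x, ∫⁻ y, rieszKernel (finrank ℝ E - 2) x y ∂ν ≤ K) {u : E → F}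
    (hu : ContDiff ℝ 1 u) (hs : HasCompactSupport u) :
    ∫⁻ x, ‖u x‖ₑ ^ 2 ∂ν ≤
      2 ^ finrank ℝ E * (μ.toSphere univ)⁻¹ * K * ∫⁻ x, ‖fderiv ℝ u x‖ₑ ^ 2 ∂μ := by
  have : Nontrivial E := Module.nontrivial_of_finrank_pos (R := ℝ) (by omega)
  set σ := μ.toSphere univ
  have hσ0 : σ ≠ 0 := Measure.measure_univ_ne_zero.mpr μ.toSphere_ne_zero
  have hσ : σ ≠ ⊤ := measure_ne_top _ _
  set k : E → E → ℝ≥0∞ := rieszKernel (finrank ℝ E - 1)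
  have hk : Measurable (Function.uncurry k) := measurable_rieszKernel _
  have schur_bound (x : E) : ∫⁻ y, k x y * ∫⁻ x', k x' y ∂ν ∂μ ≤ 2 ^ finrank ℝ E * σ * K :=
    calc ∫⁻ y, k x y * ∫⁻ x', k x' y ∂ν ∂μ = ∫⁻ y, ∫⁻ x', k x y * k x' y ∂ν ∂μ :=
          lintegral_congr fun y => (lintegral_const_mul _ hk.of_uncurry_right).symm
      _ = ∫⁻ x', ∫⁻ y, k x y * k x' y ∂μ ∂ν :=
          lintegral_lintegral_swap ((hk.of_uncurry_left.comp measurable_fst).mul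
            (hk.comp measurable_swap)).aemeasurable
      _ ≤ ∫⁻ x', 2 ^ finrank ℝ E * σ * rieszKernel (finrank ℝ E - 2) x x' ∂ν :=
          lintegral_mono fun x' => lintegral_rieszKernel_mul_rieszKernel_le μ hd x x'
      _ ≤ 2 ^ finrank ℝ E * σ * K := by
          rw [lintegral_const_mul _ (measurable_rieszKernel _).of_uncurry_left]
          gcongr
          exact hν x
  calc ∫⁻ x, ‖u x‖ₑ ^ 2 ∂ν ≤ ∫⁻ x, σ⁻¹ ^ 2 * (∫⁻ y, k x y * ‖fderiv ℝ u y‖ₑ ∂μ) ^ 2 ∂ν := by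
        refine lintegral_mono fun x => ?_
        rw [← mul_pow]
        gcongr
        exact enorm_le_lintegral_rieszKernel_fderiv μ hu hs x
    _ ≤ σ⁻¹ ^ 2 * (2 ^ finrank ℝ E * σ * K * ∫⁻ y, ‖fderiv ℝ u y‖ₑ ^ 2 ∂μ) := by
        rw [lintegral_const_mul' _ _ (ENNReal.pow_ne_top (ENNReal.inv_ne_top.mpr hσ0))]
        gcongr
        exact lintegral_sq_lintegral_mul_le hk
          (hu.continuous_fderiv one_ne_zero).enorm.measurable (by finiteness) schur_bound
    _ = σ⁻¹ * σ * (2 ^ finrank ℝ E * σ⁻¹ * K * ∫⁻ y, ‖fderiv ℝ u y‖ₑ ^ 2 ∂μ) := by ring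
    _ = _ := by rw [ENNReal.inv_mul_cancel hσ0 hσ, one_mul]

end Kato

section Poincare

variable {E F : Type*} [NormedAddCommGroup E] [NormedSpace ℝ E] [NormedAddCommGroup F]

theorem sq_enorm_sub_le_lintegral_segment [NormedSpace ℝ F] {u : E → F} (hu : ContDiff ℝ 1 u)
    (x y : E) :
    ‖u x - u y‖ₑ ^ 2 ≤
      ‖x - y‖ₑ ^ 2 * ∫⁻ t in Icc (0 : ℝ) 1, ‖fderiv ℝ u (AffineMap.lineMap x y t)‖ₑ ^ 2 := by
  set γ : ℝ → E := fun t => AffineMap.lineMap x y t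
  have hγ : ContDiff ℝ 1 γ := by
    simp only [γ, AffineMap.lineMap_apply_module']
    fun_prop
  have hDu : Measurable fun t => ‖fderiv ℝ u (γ t)‖ₑ :=
    ((hu.continuous_fderiv one_ne_zero).comp hγ.continuous).enorm.measurable
  have hderiv (t : ℝ) : ‖deriv (u ∘ γ) t‖ₑ ≤ ‖x - y‖ₑ * ‖fderiv ℝ u (γ t)‖ₑ := by
    rw [((hu.differentiable one_ne_zero _).hasFDerivAt.comp_hasDerivAt t
      AffineMap.hasDerivAt_lineMap).deriv, mul_comm, enorm_sub_rev x y]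
    exact ContinuousLinearMap.le_opENorm _ _
  have hdiff : ‖u x - u y‖ₑ ≤ ‖x - y‖ₑ * ∫⁻ t in Icc (0 : ℝ) 1, ‖fderiv ℝ u (γ t)‖ₑ :=
    calc ‖u x - u y‖ₑ = ‖(u ∘ γ) 1 - (u ∘ γ) 0‖ₑ := by
          simp [γ, enorm_sub_rev (u x)]
      _ ≤ ∫⁻ t in Icc (0 : ℝ) 1, ‖deriv (u ∘ γ) t‖ₑ :=
          enorm_sub_le_lintegral_deriv_of_contDiffOn_Icc (hu.comp hγ).contDiffOn zero_le_one
      _ ≤ _ := by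
          rw [← lintegral_const_mul _ hDu]
          exact lintegral_mono hderiv
  have hjensen : (∫⁻ t in Icc (0 : ℝ) 1, ‖fderiv ℝ u (γ t)‖ₑ) ^ 2 ≤
      ∫⁻ t in Icc (0 : ℝ) 1, ‖fderiv ℝ u (γ t)‖ₑ ^ 2 := by
    simpa using sq_lintegral_mul_le (μ := volume.restrict (Icc (0 : ℝ) 1)) hDu.aemeasurable
      (aemeasurable_const (b := (1 : ℝ≥0∞)))
  calc _ ≤ (‖x - y‖ₑ * ∫⁻ t in Icc (0 : ℝ) 1, ‖fderiv ℝ u (γ t)‖ₑ) ^ 2 := by gcongr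
    _ ≤ _ := by rw [mul_pow]; gcongr

variable [MeasurableSpace E] [BorelSpace E] {μ : Measure E} {Q : Set E}

theorem lintegral_comp_smul [FiniteDimensional ℝ E] (μ : Measure E) [μ.IsAddHaarMeasure]
    (f : E → ℝ≥0∞) {r : ℝ} (hr : r ≠ 0) :
    ∫⁻ x, f (r • x) ∂μ = ENNReal.ofReal |(r ^ finrank ℝ E)⁻¹| * ∫⁻ x, f x ∂μ := by
  rw [← smul_eq_mul, ← lintegral_smul_measure, ← Measure.map_addHaar_smul μ hr]
  exact ((Homeomorph.smulOfNeZero r hr).measurableEmbedding.lintegral_map f).symm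

theorem setLIntegral_lineMap_le_of_convex [FiniteDimensional ℝ E] [μ.IsAddHaarMeasure]
    (hQ : Convex ℝ Q) (hQm : MeasurableSet Q) (f : E → ℝ≥0∞) {x : E} (hx : x ∈ Q) {t : ℝ}
    (ht : t ∈ Icc (1 / 2) 1) :
    ∫⁻ y in Q, f (AffineMap.lineMap x y t) ∂μ ≤ 2 ^ finrank ℝ E * ∫⁻ y in Q, f y ∂μ := by
  have ht0 : 0 < t := by linarith [ht.1]
  have hjac : ENNReal.ofReal |(t ^ finrank ℝ E)⁻¹| ≤ 2 ^ finrank ℝ E := by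
    rw [abs_of_pos (by positivity), ← inv_pow, ENNReal.ofReal_pow (by positivity)]
    gcongr
    rw [← ENNReal.ofReal_ofNat]
    exact ENNReal.ofReal_le_ofReal (inv_le_of_inv_le₀ two_pos (by simpa using ht.1))
  calc ∫⁻ y in Q, f (AffineMap.lineMap x y t) ∂μ
      ≤ ∫⁻ y, Q.indicator f ((1 - t) • x + t • y) ∂μ := by
        rw [← lintegral_indicator hQm]
        refine lintegral_mono (indicator_le fun y hy => ?_)
        rw [← AffineMap.lineMap_apply_module, indicator_of_mem
          (hQ.lineMap_mem hx hy ⟨ht0.le, ht.2⟩)]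
    _ = ENNReal.ofReal |(t ^ finrank ℝ E)⁻¹| * ∫⁻ y in Q, f y ∂μ := by
        rw [lintegral_comp_smul μ (fun z => Q.indicator f ((1 - t) • x + z)) ht0.ne',
          lintegral_add_left_eq_self, lintegral_indicator hQm]
    _ ≤ _ := by gcongr

theorem lintegral_prod_lineMap_le_of_convex [FiniteDimensional ℝ E] [μ.IsAddHaarMeasure]
    (hQ : Convex ℝ Q) (hQm : MeasurableSet Q) {f : E → ℝ≥0∞} (hf : Measurable f) {t : ℝ}
    (ht : t ∈ Icc 0 1) :
    ∫⁻ p, f (AffineMap.lineMap p.1 p.2 t) ∂((μ.restrict Q).prod (μ.restrict Q)) ≤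
      2 ^ finrank ℝ E * μ Q * ∫⁻ x in Q, f x ∂μ := by
  have hft : Measurable fun p : E × E => f (AffineMap.lineMap p.1 p.2 t) := by
    simp only [AffineMap.lineMap_apply_module]
    fun_prop
  set I := ∫⁻ x in Q, f x ∂μ
  have integrate_const {g : E → ℝ≥0∞} (hg : ∀ x ∈ Q, g x ≤ 2 ^ finrank ℝ E * I) :
      ∫⁻ x in Q, g x ∂μ ≤ 2 ^ finrank ℝ E * μ Q * I :=
    (setLIntegral_mono' hQm hg).trans_eq (by rw [setLIntegral_const]; ring)
  rcases le_total (1 / 2) t with h | h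
  · rw [lintegral_prod _ hft.aemeasurable]
    exact integrate_const fun x hx => setLIntegral_lineMap_le_of_convex hQ hQm f hx ⟨h, ht.2⟩
  · rw [lintegral_prod_symm _ hft.aemeasurable]
    refine integrate_const fun y hy => ?_
    simp only [← AffineMap.lineMap_apply_one_sub _ _ t]
    exact setLIntegral_lineMap_le_of_convex hQ hQm f hy ⟨by linarith, by linarith [ht.1]⟩

theorem lintegral_sq_enorm_sub_le_of_convex [FiniteDimensional ℝ E] [μ.IsAddHaarMeasure]
    [NormedSpace ℝ F] (hQ : Convex ℝ Q) (hQm : MeasurableSet Q) {u : E → F}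
    (hu : ContDiff ℝ 1 u) :
    ∫⁻ p, ‖u p.1 - u p.2‖ₑ ^ 2 ∂((μ.restrict Q).prod (μ.restrict Q)) ≤
      2 ^ finrank ℝ E * Metric.ediam Q ^ 2 * μ Q * ∫⁻ x in Q, ‖fderiv ℝ u x‖ₑ ^ 2 ∂μ := by
  set π := (μ.restrict Q).prod (μ.restrict Q)
  have hDu : Measurable fun x => ‖fderiv ℝ u x‖ₑ ^ 2 :=
    (hu.continuous_fderiv one_ne_zero).enorm.measurable.pow_const 2
  have hline : Measurable fun p : (E × E) × ℝ =>
      ‖fderiv ℝ u (AffineMap.lineMap p.1.1 p.1.2 p.2)‖ₑ ^ 2 := by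
    simp only [AffineMap.lineMap_apply_module]
    exact hDu.comp (by fun_prop)
  have hmem : ∀ᵐ p ∂π, p ∈ Q ×ˢ Q := by
    rw [show π = _ from Measure.prod_restrict Q Q]
    exact ae_restrict_mem (hQm.prod hQm)
  calc ∫⁻ p, ‖u p.1 - u p.2‖ₑ ^ 2 ∂π
      ≤ ∫⁻ p, Metric.ediam Q ^ 2 * (∫⁻ t in Icc (0 : ℝ) 1,
          ‖fderiv ℝ u (AffineMap.lineMap p.1 p.2 t)‖ₑ ^ 2) ∂π := by
        refine lintegral_mono_ae (hmem.mono fun p hp => ?_)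
        refine (sq_enorm_sub_le_lintegral_segment hu p.1 p.2).trans ?_
        rw [← edist_eq_enorm_sub]
        gcongr
        exact Metric.edist_le_ediam_of_mem hp.1 hp.2
    _ = Metric.ediam Q ^ 2 * ∫⁻ t in Icc (0 : ℝ) 1, (∫⁻ p : E × E,
          ‖fderiv ℝ u (AffineMap.lineMap p.1 p.2 t)‖ₑ ^ 2 ∂π) := by
        rw [lintegral_const_mul _ hline.lintegral_prod_right',
          lintegral_lintegral_swap hline.aemeasurable]
    _ ≤ Metric.ediam Q ^ 2 * ∫⁻ _ in Icc (0 : ℝ) 1,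
          2 ^ finrank ℝ E * μ Q * ∫⁻ x in Q, ‖fderiv ℝ u x‖ₑ ^ 2 ∂μ := by
        gcongr 1
        exact setLIntegral_mono' measurableSet_Icc fun t ht =>
          lintegral_prod_lineMap_le_of_convex hQ hQm hDu ht
    _ = _ := by
        rw [setLIntegral_const, Real.volume_Icc, sub_zero, ENNReal.ofReal_one]
        ring

omit [NormedAddCommGroup E] [NormedSpace ℝ E] [BorelSpace E] in
theorem lintegral_sq_enorm_le_of_integral_eq_zero [NormedSpace ℝ F] [CompleteSpace F]
    [IsFiniteMeasure μ] {u : E → F} (hu : Integrable u μ) (h0 : ∫ x, u x ∂μ = 0) :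
    ∫⁻ x, ‖u x‖ₑ ^ 2 ∂μ ≤ (μ univ)⁻¹ * ∫⁻ p, ‖u p.1 - u p.2‖ₑ ^ 2 ∂(μ.prod μ) := by
  obtain rfl | hμ := eq_zero_or_neZero μ
  · simp
  have hμ0 : μ univ ≠ 0 := NeZero.ne _
  have hdiff (x : E) : μ univ * ‖u x‖ₑ ≤ ∫⁻ y, ‖u x - u y‖ₑ ∂μ := by
    have hmean : μ.real univ • u x = ∫ y, (u x - u y) ∂μ := by
      rw [integral_sub (integrable_const _) hu, h0, sub_zero, integral_const]
    calc μ univ * ‖u x‖ₑ = ‖μ.real univ • u x‖ₑ := by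
          rw [enorm_smul, Real.enorm_of_nonneg measureReal_nonneg, ofReal_measureReal]
      _ ≤ ∫⁻ y, ‖u x - u y‖ₑ ∂μ := by rw [hmean]; exact enorm_integral_le_lintegral_enorm _
  have hjensen (x : E) : (∫⁻ y, ‖u x - u y‖ₑ ∂μ) ^ 2 ≤
      (∫⁻ y, ‖u x - u y‖ₑ ^ 2 ∂μ) * μ univ := by
    simpa using sq_lintegral_mul_le (aestronglyMeasurable_const.sub hu.1).enorm
      (aemeasurable_const (b := (1 : ℝ≥0∞)))
  rw [lintegral_prod (fun p : E × E => ‖u p.1 - u p.2‖ₑ ^ 2)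
      ((hu.1.comp_fst.sub hu.1.comp_snd).enorm.pow_const 2),
    ← lintegral_const_mul' _ _ (ENNReal.inv_ne_top.mpr hμ0)]
  refine lintegral_mono fun x => ?_
  calc ‖u x‖ₑ ^ 2 = ((μ univ)⁻¹ * (μ univ * ‖u x‖ₑ)) ^ 2 := by
        rw [ENNReal.inv_mul_cancel_left hμ0 (measure_ne_top _ _)]
    _ ≤ (μ univ)⁻¹ ^ 2 * ((∫⁻ y, ‖u x - u y‖ₑ ^ 2 ∂μ) * μ univ) := by
        rw [mul_pow]
        gcongr
        exact (pow_le_pow_left' (hdiff x) 2).trans (hjensen x)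
    _ = (μ univ)⁻¹ * ((μ univ)⁻¹ * (μ univ * ∫⁻ y, ‖u x - u y‖ₑ ^ 2 ∂μ)) := by ring
    _ = _ := by rw [ENNReal.inv_mul_cancel_left hμ0 (measure_ne_top _ _)]

end Poincare

section Approximation

open scoped Convolution

theorem lintegral_sq_enorm_convolution_le {H F : Type*} [AddGroup H] [MeasurableSpace H]
    [MeasurableAdd₂ H] [MeasurableNeg H] [NormedAddCommGroup F] [NormedSpace ℝ F]
    {μ : Measure H} [SFinite μ] [μ.IsAddRightInvariant] {φ : H → ℝ} (hφ : Measurable φ)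
    {u : H → F} (hu : StronglyMeasurable u) :
    ∫⁻ x, ‖(φ ⋆[ContinuousLinearMap.lsmul ℝ ℝ, μ] u) x‖ₑ ^ 2 ∂μ ≤
      (∫⁻ t, ‖φ t‖ₑ ∂μ) ^ 2 * ∫⁻ x, ‖u x‖ₑ ^ 2 ∂μ := by
  have hum : Measurable fun x => ‖u x‖ₑ := hu.enorm
  have hcs (x : H) : ‖(φ ⋆[ContinuousLinearMap.lsmul ℝ ℝ, μ] u) x‖ₑ ^ 2 ≤
      (∫⁻ t, ‖φ t‖ₑ ∂μ) * ∫⁻ t, ‖φ t‖ₑ * ‖u (x - t)‖ₑ ^ 2 ∂μ := by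
    have hx : Measurable fun t => ‖u (x - t)‖ₑ := hum.comp (measurable_const.sub measurable_id)
    have hJ := sq_lintegral_mul_le (μ := μ.withDensity fun t => ‖φ t‖ₑ) hx.aemeasurable
      (aemeasurable_const (b := (1 : ℝ≥0∞)))
    simp only [mul_one, one_pow] at hJ
    rw [lintegral_withDensity_eq_lintegral_mul _ (by fun_prop) (by fun_prop),
      lintegral_withDensity_eq_lintegral_mul _ (by fun_prop) (by fun_prop), lintegral_const,
      one_mul, withDensity_apply _ .univ, setLIntegral_univ,
      mul_comm (lintegral _ _) (lintegral _ _)] at hJ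
    refine le_trans (pow_le_pow_left' ?_ 2) hJ
    refine (enorm_integral_le_lintegral_enorm _).trans_eq ?_
    simp only [ContinuousLinearMap.lsmul_apply, enorm_smul, Pi.mul_apply]
  have hmeas : Measurable fun p : H × H => ‖φ p.2‖ₑ * ‖u (p.1 - p.2)‖ₑ ^ 2 :=
    (hφ.comp measurable_snd).enorm.mul ((hum.comp (by fun_prop)).pow_const 2)
  calc _ ≤ ∫⁻ x, (∫⁻ t, ‖φ t‖ₑ ∂μ) * (∫⁻ t, ‖φ t‖ₑ * ‖u (x - t)‖ₑ ^ 2 ∂μ) ∂μ := lintegral_mono hcs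
    _ = (∫⁻ t, ‖φ t‖ₑ ∂μ) * ∫⁻ t, (∫⁻ x, ‖φ t‖ₑ * ‖u (x - t)‖ₑ ^ 2 ∂μ) ∂μ := by
      rw [lintegral_const_mul _ hmeas.lintegral_prod_right',
        lintegral_lintegral_swap hmeas.aemeasurable]
    _ = (∫⁻ t, ‖φ t‖ₑ ∂μ) * ∫⁻ t, ‖φ t‖ₑ * (∫⁻ x, ‖u x‖ₑ ^ 2 ∂μ) ∂μ := by
      congr 1
      refine lintegral_congr fun t => ?_
      rw [lintegral_const_mul' _ _ enorm_ne_top,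
        lintegral_sub_right_eq_self (fun x => ‖u x‖ₑ ^ 2) t]
    _ = _ := by rw [lintegral_mul_const _ (by fun_prop), ← mul_assoc, sq]

theorem lintegral_enorm_normed {E : Type*} [NormedAddCommGroup E] [NormedSpace ℝ E]
    [HasContDiffBump E] [FiniteDimensional ℝ E] [MeasurableSpace E] [BorelSpace E]
    {μ : Measure E} [IsLocallyFiniteMeasure μ] [μ.IsOpenPosMeasure] {c : E} (b : ContDiffBump c) :
    ∫⁻ x, ‖b.normed μ x‖ₑ ∂μ = 1 := by
  rw [← ofReal_integral_norm_eq_lintegral_enorm b.integrable_normed,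
    integral_congr_ae (.of_forall fun x => Real.norm_of_nonneg (b.nonneg_normed x)),
    b.integral_normed, ENNReal.ofReal_one]

theorem sq_enorm_add_le {F : Type*} [NormedAddCommGroup F] (x y : F) :
    ‖x + y‖ₑ ^ 2 ≤ 2 * ‖x‖ₑ ^ 2 + 2 * ‖y‖ₑ ^ 2 := by
  have h := ENNReal.rpow_add_le_mul_rpow_add_rpow ‖x‖ₑ ‖y‖ₑ one_le_two
  norm_num [mul_add] at h
  exact (pow_le_pow_left' (enorm_add_le x y) 2).trans h

theorem sq_enorm_le_sum_sq_enorm_single {ι F : Type*} [Fintype ι] [DecidableEq ι]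
    [NormedAddCommGroup F] [NormedSpace ℝ F] (L : EuclideanSpace ℝ ι →L[ℝ] F) :
    ‖L‖ₑ ^ 2 ≤ ∑ i, ‖L (EuclideanSpace.single i 1)‖ₑ ^ 2 := by
  have hL : ‖L‖ ≤ √(∑ i, ‖L (EuclideanSpace.single i 1)‖ ^ 2) := by
    refine L.opNorm_le_bound (Real.sqrt_nonneg _) fun x => ?_
    have hx : x = ∑ i, x i • EuclideanSpace.single i (1 : ℝ) := by
      ext j
      simp [Pi.single_apply]
    calc ‖L x‖ = ‖∑ i, x i • L (EuclideanSpace.single i 1)‖ := by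
          conv_lhs => rw [hx]
          simp only [map_sum, map_smul]
      _ ≤ ∑ i, ‖L (EuclideanSpace.single i 1)‖ * ‖x i‖ := by
          refine (norm_sum_le _ _).trans_eq (Finset.sum_congr rfl fun i _ => ?_)
          rw [norm_smul, mul_comm]
      _ ≤ _ := by
          rw [EuclideanSpace.norm_eq]
          exact Real.sum_mul_le_sqrt_mul_sqrt _ _ _
  simp_rw [← ofReal_norm, ← ENNReal.ofReal_pow (norm_nonneg _)]
  rw [← ENNReal.ofReal_sum_of_nonneg fun i _ => by positivity]
  exact ENNReal.ofReal_le_ofReal ((Real.le_sqrt (norm_nonneg _) (by positivity)).mp hL)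

theorem lintegral_sq_enorm_fderiv_smul_le {E F : Type*} [NormedAddCommGroup E] [NormedSpace ℝ E]
    [MeasurableSpace E] [OpensMeasurableSpace E] [NormedAddCommGroup F] [NormedSpace ℝ F]
    (μ : Measure E) {χ : E → ℝ} (hχ : ContDiff ℝ 1 χ) (hχ1 : ∀ x, ‖χ x‖ ≤ 1) {ε : ℝ}
    (hε : ∀ x, ‖fderiv ℝ χ x‖ ≤ ε) {v : E → F} (hv : ContDiff ℝ 1 v) :
    ∫⁻ x, ‖fderiv ℝ (fun y => χ y • v y) x‖ₑ ^ 2 ∂μ ≤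
      2 * ∫⁻ x, ‖fderiv ℝ v x‖ₑ ^ 2 ∂μ + 2 * ENNReal.ofReal ε ^ 2 * ∫⁻ x, ‖v x‖ₑ ^ 2 ∂μ := by
  have hpoint (x : E) : ‖fderiv ℝ (fun y => χ y • v y) x‖ₑ ^ 2 ≤
      2 * ‖fderiv ℝ v x‖ₑ ^ 2 + 2 * ENNReal.ofReal ε ^ 2 * ‖v x‖ₑ ^ 2 := by
    rw [fderiv_fun_smul (hχ.differentiable one_ne_zero x) (hv.differentiable one_ne_zero x)]
    refine (sq_enorm_add_le _ _).trans ?_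
    rw [mul_assoc, ← mul_pow]
    simp_rw [← ofReal_norm, ← ENNReal.ofReal_mul ((norm_nonneg _).trans (hε x)),
      ContinuousLinearMap.norm_smulRight_apply, norm_smul]
    gcongr
    · exact mul_le_of_le_one_left (norm_nonneg _) (hχ1 x)
    · exact hε x
  have hDv : Measurable fun x => ‖fderiv ℝ v x‖ₑ ^ 2 :=
    (hv.continuous_fderiv one_ne_zero).enorm.measurable.pow_const 2
  refine (lintegral_mono hpoint).trans_eq ?_
  rw [lintegral_add_left (hDv.const_mul 2), lintegral_const_mul _ hDv,
    lintegral_const_mul _ (hv.continuous.enorm.measurable.pow_const 2)]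

theorem exists_cutoff_sequence (E : Type*) [NormedAddCommGroup E] [NormedSpace ℝ E]
    [FiniteDimensional ℝ E] :
    ∃ (χ : ℕ → E → ℝ) (M : ℝ), ∀ n, ContDiff ℝ 1 (χ n) ∧ HasCompactSupport (χ n) ∧
      (∀ x, ‖χ n x‖ ≤ 1) ∧ (∀ x, ‖fderiv ℝ (χ n) x‖ ≤ M * ((n : ℝ) + 1)⁻¹) ∧
      ∀ x, ‖x‖ ≤ n → χ n x = 1 := by
  let b : ContDiffBump (0 : E) := ⟨1, 2, one_pos, one_lt_two⟩
  have hb : ContDiff ℝ 1 b := b.contDiff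
  obtain ⟨M, hM⟩ := (hb.continuous_fderiv one_ne_zero).bounded_above_of_compact_support
    (b.hasCompactSupport.fderiv ℝ)
  refine ⟨fun n x => b (((n : ℝ) + 1)⁻¹ • x), M, fun n => ?_⟩
  have hn : (0 : ℝ) < n + 1 := by positivity
  refine ⟨hb.comp (by fun_prop), b.hasCompactSupport.comp_smul (inv_ne_zero hn.ne'),
    fun x => ?_, fun x => ?_, fun x hx => ?_⟩
  · rw [Real.norm_of_nonneg b.nonneg]
    exact b.le_one
  · rw [fderiv_comp_smul, norm_smul, mul_comm, norm_inv, Real.norm_of_nonneg hn.le]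
    gcongr
    exact hM _
  · apply b.one_of_mem_closedBall
    rw [mem_closedBall_zero_iff, norm_smul, norm_inv, Real.norm_of_nonneg hn.le]
    change _ ≤ (1 : ℝ)
    rw [inv_mul_le_iff₀ hn]
    linarith

end Approximation

section Sobolev

open scoped Convolution

variable {u : L2} {G : Fin 3 → L2}

theorem lintegral_sq_enorm_L2 (u : L2) : ∫⁻ x, ‖u x‖ₑ ^ 2 = ‖u‖ₑ ^ 2 := by
  rw [Lp.enorm_def]
  simpa [ENNReal.rpow_two] using (eLpNorm_nnreal_pow_eq_lintegral (p := 2) two_ne_zero).symm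

theorem HasWeakGradient.fderiv_convolution (h : HasWeakGradient u G) {φ : R3 → ℝ}
    (hφ : ContDiff ℝ ∞ φ) (hs : HasCompactSupport φ) (x : R3) (i : Fin 3) :
    fderiv ℝ (φ ⋆[ContinuousLinearMap.lsmul ℝ ℝ] u : R3 → ℂ) x (EuclideanSpace.single i 1) =
      (φ ⋆[ContinuousLinearMap.lsmul ℝ ℝ] G i) x := by
  have hloc : LocallyIntegrable u volume := (Lp.memLp u).locallyIntegrable one_le_two
  have hreflect (t : R3) : fderiv ℝ (fun t => φ (x - t)) t = -fderiv ℝ φ (x - t) := by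
    simpa [Function.comp_def] using ((hφ.differentiable (by simp) (x - t)).hasFDerivAt.comp t
      ((hasFDerivAt_id t).const_sub x)).fderiv
  have hweak := h i _ (hφ.comp (contDiff_const.sub contDiff_id))
    (hs.comp_homeomorph (Homeomorph.subLeft x))
  simp only [Function.comp_def, id, hreflect, neg_apply, neg_smul,
    integral_neg, neg_inj] at hweak
  have hexists := (hs.fderiv ℝ).convolutionExists_left
    ((ContinuousLinearMap.lsmul ℝ ℝ : ℝ →L[ℝ] ℂ →L[ℝ] ℂ).precompL R3)
    (hφ.continuous_fderiv (by simp)) hloc x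
  rw [(hs.hasFDerivAt_convolution_left _ (hφ.of_le (by simp)) hloc x).fderiv, convolution_def,
    ContinuousLinearMap.integral_apply hexists, convolution_def]
  simp only [ContinuousLinearMap.precompL_apply, ContinuousLinearMap.lsmul_apply]
  rw [← integral_sub_left_eq_self _ volume x,
    ← integral_sub_left_eq_self (fun t => φ t • G i (x - t)) volume x]
  simpa only [sub_sub_cancel] using hweak

theorem HasWeakGradient.exists_contDiff_tendsto (h : HasWeakGradient u G) :
    ∃ v : ℕ → R3 → ℂ, (∀ᵐ x, Tendsto (fun n => v n x) atTop (𝓝 (u x))) ∧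
      ∀ n, ContDiff ℝ 1 (v n) ∧ ∫⁻ x, ‖v n x‖ₑ ^ 2 ≤ ‖u‖ₑ ^ 2 ∧
        ∫⁻ x, ‖fderiv ℝ (v n) x‖ₑ ^ 2 ≤ ∑ i, ‖G i‖ₑ ^ 2 := by
  let r (n : ℕ) : ℝ := ((n : ℝ) + 1)⁻¹
  have hr0 (n : ℕ) : 0 < r n := by positivity
  have hr : Tendsto r atTop (𝓝 0) := by
    simpa [r, one_div] using tendsto_one_div_add_atTop_nhds_zero_nat (𝕜 := ℝ)
  let b (n : ℕ) : ContDiffBump (0 : R3) := ⟨r n, 2 * r n, hr0 n, by linarith [hr0 n]⟩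
  let φ (n : ℕ) : R3 → ℝ := (b n).normed volume
  have hφ (n : ℕ) : ContDiff ℝ ∞ (φ n) := (b n).contDiff_normed
  have hφs (n : ℕ) : HasCompactSupport (φ n) := (b n).hasCompactSupport_normed
  have hloc : LocallyIntegrable u volume := (Lp.memLp u).locallyIntegrable one_le_two
  have young (n : ℕ) (f : L2) :
      ∫⁻ x, ‖(φ n ⋆[ContinuousLinearMap.lsmul ℝ ℝ] f) x‖ₑ ^ 2 ≤ ‖f‖ₑ ^ 2 := by
    simpa [φ, lintegral_enorm_normed, lintegral_sq_enorm_L2] using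
      lintegral_sq_enorm_convolution_le (μ := volume) (hφ n).continuous.measurable
        (Lp.stronglyMeasurable f)
  have hsmooth (n : ℕ) :
      ContDiff ℝ 1 (φ n ⋆[ContinuousLinearMap.lsmul ℝ ℝ] u : R3 → ℂ) :=
    (hφs n).contDiff_convolution_left _ ((hφ n).of_le (by simp)) hloc
  refine ⟨fun n => φ n ⋆[ContinuousLinearMap.lsmul ℝ ℝ] u, ?_,
    fun n => ⟨hsmooth n, young n u, ?_⟩⟩
  · exact ContDiffBump.ae_convolution_tendsto_right_of_locallyIntegrable (φ := b) (K := 2)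
      (by simpa using hr.const_mul 2) (.of_forall fun n => le_rfl) hloc
  · refine (lintegral_mono fun x => sq_enorm_le_sum_sq_enorm_single _).trans ?_
    simp_rw [h.fderiv_convolution (hφ n) (hφs n)]
    rw [lintegral_finsetSum' _ fun i _ => ?_]
    · exact Finset.sum_le_sum fun i _ => young n (G i)
    · have hGi : LocallyIntegrable (G i) volume := (Lp.memLp (G i)).locallyIntegrable one_le_two
      have hcont := (hφs n).continuous_convolution_left
        (ContinuousLinearMap.lsmul ℝ ℝ) (hφ n).continuous hGi
      exact hcont.enorm.aemeasurable.pow_const 2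

theorem HasWeakGradient.exists_hasCompactSupport_tendsto (h : HasWeakGradient u G) :
    ∃ (w : ℕ → R3 → ℂ) (c : ℕ → ℝ≥0∞),
      (∀ᵐ x, Tendsto (fun n => w n x) atTop (𝓝 (u x))) ∧
      Tendsto c atTop (𝓝 (2 * ∑ i, ‖G i‖ₑ ^ 2)) ∧
      ∀ n, ContDiff ℝ 1 (w n) ∧ HasCompactSupport (w n) ∧
        ∫⁻ x, ‖fderiv ℝ (w n) x‖ₑ ^ 2 ≤ c n := by
  obtain ⟨v, hlim, hv⟩ := h.exists_contDiff_tendsto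
  obtain ⟨χ, M, hχ⟩ := exists_cutoff_sequence R3
  let ε (n : ℕ) : ℝ≥0∞ := ENNReal.ofReal (M * ((n : ℝ) + 1)⁻¹)
  have hε : Tendsto ε atTop (𝓝 0) := by
    rw [← ENNReal.ofReal_zero]
    refine ENNReal.tendsto_ofReal ?_
    simpa [one_div] using (tendsto_one_div_add_atTop_nhds_zero_nat (𝕜 := ℝ)).const_mul M
  refine ⟨fun n x => χ n x • v n x, fun n => 2 * ∑ i, ‖G i‖ₑ ^ 2 + 2 * ε n ^ 2 * ‖u‖ₑ ^ 2,
    ?_, ?_, fun n => ?_⟩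
  · filter_upwards [hlim] with x hx
    refine hx.congr' ?_
    filter_upwards [eventually_ge_atTop ⌈‖x‖⌉₊] with n hn
    rw [(hχ n).2.2.2.2 x (Nat.ceil_le.mp hn), one_smul]
  · have hε2 : Tendsto (fun n => 2 * ε n ^ 2) atTop (𝓝 0) := by
      simpa using ENNReal.Tendsto.const_mul (ENNReal.Tendsto.pow hε (n := 2))
        (Or.inr ENNReal.ofNat_ne_top)
    simpa using tendsto_const_nhds.add (ENNReal.Tendsto.mul_const hε2
      (Or.inr (ENNReal.pow_ne_top enorm_ne_top)))
  · obtain ⟨hχC, hχs, hχ1, hχd, -⟩ := hχ n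
    obtain ⟨hvC, hvu, hvG⟩ := hv n
    refine ⟨hχC.smul hvC, hχs.smul_right,
      (lintegral_sq_enorm_fderiv_smul_le volume hχC hχ1 hχd hvC).trans ?_⟩
    simp only [ε]
    gcongr

theorem lintegral_sq_enorm_le_of_tendsto {Ω F : Type*} [MeasurableSpace Ω] {ρ : Measure Ω}
    [NormedAddCommGroup F] {f : ℕ → Ω → F} {g : Ω → F} {c : ℕ → ℝ≥0∞} {b : ℝ≥0∞}
    (hf : ∀ n, AEStronglyMeasurable (f n) ρ)
    (hfg : ∀ᵐ p ∂ρ, Tendsto (fun n => f n p) atTop (𝓝 (g p))) (hc : Tendsto c atTop (𝓝 b))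
    (h : ∀ n, ∫⁻ p, ‖f n p‖ₑ ^ 2 ∂ρ ≤ c n) : ∫⁻ p, ‖g p‖ₑ ^ 2 ∂ρ ≤ b :=
  calc ∫⁻ p, ‖g p‖ₑ ^ 2 ∂ρ = ∫⁻ p, liminf (fun n => ‖f n p‖ₑ ^ 2) atTop ∂ρ :=
        lintegral_congr_ae (hfg.mono fun _ hp => (ENNReal.Tendsto.pow hp.enorm).liminf_eq.symm)
    _ ≤ liminf (fun n => ∫⁻ p, ‖f n p‖ₑ ^ 2 ∂ρ) atTop :=
        lintegral_liminf_le' fun n => (hf n).enorm.pow_const 2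
    _ ≤ liminf c atTop := liminf_le_liminf (.of_forall h)
    _ = b := hc.liminf_eq

theorem HasWeakGradient.lintegral_sq_enorm_le (h : HasWeakGradient u G) {ν : Measure R3}
    [SFinite ν] (hν : ν ≪ volume) {K : ℝ≥0∞} (hK : K ≠ ⊤)
    (hνK : ∀ x, ∫⁻ y, rieszKernel 1 x y ∂ν ≤ K) :
    ∫⁻ x, ‖u x‖ₑ ^ 2 ∂ν ≤
      2 ^ 3 * ((volume : Measure R3).toSphere univ)⁻¹ * K * (2 * ∑ i, ‖G i‖ₑ ^ 2) := by
  have hdim : finrank ℝ R3 = 3 := by simp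
  obtain ⟨w, c, hlim, hc, hw⟩ := h.exists_hasCompactSupport_tendsto
  refine lintegral_sq_enorm_le_of_tendsto
    (fun n => (hw n).1.continuous.aestronglyMeasurable) (hν.ae_le hlim)
    (ENNReal.Tendsto.const_mul hc (Or.inr ?_)) fun n => ?_
  · exact ENNReal.mul_ne_top (ENNReal.mul_ne_top (by simp) (ENNReal.inv_ne_top.mpr
      (Measure.measure_univ_ne_zero.mpr (Measure.toSphere_ne_zero _)))) hK
  · obtain ⟨hwC, hws, hwc⟩ := hw n
    refine (lintegral_sq_enorm_le_of_contDiff (K := K) volume (by simp) hK ?_ hwC hws).trans ?_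
    · simpa [hdim] using hνK
    · rw [hdim]
      gcongr

end Sobolev

section Cells

variable {E F : Type*} [MeasurableSpace E] [NormedAddCommGroup F] [NormedSpace ℝ F]

/-- The measure on pairs of points lying in a common cell of `𝒬`: the sum of the product measures
on `Q × Q`, each normalized by `μ Q`. It turns Poincaré's inequality on all cells simultaneously
into a bound for one integral, to which Fatou's lemma applies. -/
noncomputable def cellPairMeasure (μ : Measure E) (𝒬 : Finset (Set E)) : Measure (E × E) :=
  ∑ Q ∈ 𝒬, (μ Q)⁻¹ • (μ.restrict Q).prod (μ.restrict Q)

theorem cellPairMeasure_absolutelyContinuous (μ : Measure E) [SFinite μ] (𝒬 : Finset (Set E)) :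
    cellPairMeasure μ 𝒬 ≪ μ.prod μ := by
  refine Measure.AbsolutelyContinuous.mk fun s _ hs => ?_
  rw [cellPairMeasure, Measure.finsetSum_apply]
  exact Finset.sum_eq_zero fun Q _ => (Measure.smul_absolutelyContinuous.trans
    (Measure.restrict_le_self.absolutelyContinuous.prod
      Measure.restrict_le_self.absolutelyContinuous)) hs

theorem setLIntegral_sq_enorm_le_cellPairMeasure [CompleteSpace F] {μ : Measure E}
    {𝒬 : Finset (Set E)} (hdisj : (𝒬 : Set (Set E)).PairwiseDisjoint id)
    (h𝒬 : ∀ Q ∈ 𝒬, MeasurableSet Q ∧ μ Q ≠ ⊤) {u : E → F}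
    (hu : ∀ Q ∈ 𝒬, IntegrableOn u Q μ) (h0 : ∀ Q ∈ 𝒬, ∫ x in Q, u x ∂μ = 0) :
    ∫⁻ x in ⋃ Q ∈ 𝒬, Q, ‖u x‖ₑ ^ 2 ∂μ ≤ ∫⁻ p, ‖u p.1 - u p.2‖ₑ ^ 2 ∂cellPairMeasure μ 𝒬 := by
  rw [cellPairMeasure, lintegral_finsetSum_measure,
    lintegral_biUnion_finset (t := fun Q => Q) hdisj fun Q hQ => (h𝒬 Q hQ).1]
  refine Finset.sum_le_sum fun Q hQ => ?_
  have : IsFiniteMeasure (μ.restrict Q) := ⟨by simpa using (h𝒬 Q hQ).2.lt_top⟩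
  rw [lintegral_smul_measure, smul_eq_mul]
  simpa using lintegral_sq_enorm_le_of_integral_eq_zero (hu Q hQ) (h0 Q hQ)

variable [NormedAddCommGroup E] [NormedSpace ℝ E] [FiniteDimensional ℝ E] [BorelSpace E]

theorem lintegral_sq_enorm_sub_cellPairMeasure_le (μ : Measure E) [μ.IsAddHaarMeasure]
    {𝒬 : Finset (Set E)} (hdisj : (𝒬 : Set (Set E)).PairwiseDisjoint id) {d : ℝ≥0∞}
    (h𝒬 : ∀ Q ∈ 𝒬, Convex ℝ Q ∧ MeasurableSet Q ∧ Metric.ediam Q ≤ d) {u : E → F}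
    (hu : ContDiff ℝ 1 u) :
    ∫⁻ p, ‖u p.1 - u p.2‖ₑ ^ 2 ∂cellPairMeasure μ 𝒬 ≤
      2 ^ finrank ℝ E * d ^ 2 * ∫⁻ x, ‖fderiv ℝ u x‖ₑ ^ 2 ∂μ := by
  rw [cellPairMeasure, lintegral_finsetSum_measure]
  calc _ ≤ ∑ Q ∈ 𝒬, 2 ^ finrank ℝ E * d ^ 2 * ∫⁻ x in Q, ‖fderiv ℝ u x‖ₑ ^ 2 ∂μ := by
        refine Finset.sum_le_sum fun Q hQ => ?_
        obtain ⟨hconv, hmeas, hdiam⟩ := h𝒬 Q hQ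
        rw [lintegral_smul_measure, smul_eq_mul]
        refine (mul_le_mul_right (lintegral_sq_enorm_sub_le_of_convex hconv hmeas hu) _).trans ?_
        calc _ = ((μ Q)⁻¹ * μ Q) * (2 ^ finrank ℝ E * Metric.ediam Q ^ 2 *
              ∫⁻ x in Q, ‖fderiv ℝ u x‖ₑ ^ 2 ∂μ) := by ring
          _ ≤ 1 * (2 ^ finrank ℝ E * d ^ 2 * ∫⁻ x in Q, ‖fderiv ℝ u x‖ₑ ^ 2 ∂μ) := by
            gcongr
            exact ENNReal.inv_mul_le_one _
          _ = _ := one_mul _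
    _ = 2 ^ finrank ℝ E * d ^ 2 * ∫⁻ x in ⋃ Q ∈ 𝒬, Q, ‖fderiv ℝ u x‖ₑ ^ 2 ∂μ := by
        rw [← Finset.mul_sum,
          lintegral_biUnion_finset (t := fun Q => Q) hdisj fun Q hQ => (h𝒬 Q hQ).2.1]
    _ ≤ _ := by
        gcongr
        exact Measure.restrict_le_self

theorem exists_finset_convex_cover {S : Set E} (hS : Bornology.IsBounded S) {d : ℝ≥0∞}
    (hd : d ≠ 0) :
    ∃ 𝒬 : Finset (Set E), S ⊆ ⋃ Q ∈ 𝒬, Q ∧ (𝒬 : Set (Set E)).PairwiseDisjoint id ∧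
      ∀ Q ∈ 𝒬, Convex ℝ Q ∧ MeasurableSet Q ∧ Metric.ediam Q ≤ d := by
  classical
  let e : E ≃L[ℝ] (Fin (finrank ℝ E) → ℝ) := .ofFinrankEq (by simp)
  obtain ⟨B, hB, hSB⟩ := BoxIntegral.le_hasIntegralVertices_of_isBounded
    (e.lipschitz.isBounded_image hS)
  obtain ⟨n, hn⟩ := ENNReal.exists_nat_mul_gt hd
    (ENNReal.coe_ne_top (r := ‖(e.symm : (Fin (finrank ℝ E) → ℝ) →L[ℝ] E)‖₊))
  have : NeZero n := ⟨by rintro rfl; simp at hn⟩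
  let P := BoxIntegral.unitPartition.prepartition n B
  refine ⟨P.boxes.image fun I : BoxIntegral.Box (Fin (finrank ℝ E)) =>
    e ⁻¹' (I : Set (Fin (finrank ℝ E) → ℝ)), fun x hx => ?_, ?_, ?_⟩
  · obtain ⟨I, hI, hxI⟩ := BoxIntegral.unitPartition.prepartition_isPartition n hB
      (e x) (hSB (mem_image_of_mem e hx))
    exact mem_biUnion (Finset.mem_image_of_mem _ hI) hxI
  · rw [Finset.coe_image]
    rintro _ ⟨I, hI, rfl⟩ _ ⟨J, hJ, rfl⟩ hne
    exact (P.disjoint_coe_of_mem hI hJ fun h => hne (by rw [h])).preimage e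
  · simp only [Finset.forall_mem_image]
    intro I hI
    obtain ⟨k, -, rfl⟩ := BoxIntegral.unitPartition.mem_prepartition_iff.mp hI
    have hdiam : Metric.ediam (BoxIntegral.unitPartition.box n k : Set (Fin (finrank ℝ E) → ℝ)) ≤
        (n : ℝ≥0∞)⁻¹ := by
      refine (Metric.ediam_mono BoxIntegral.Box.coe_subset_Icc).trans ?_
      rw [BoxIntegral.Box.Icc_eq_pi]
      refine Metric.ediam_pi_le_of_le fun i => ?_
      rw [Real.ediam_Icc, BoxIntegral.unitPartition.box.upper_sub_lower, one_div,
        ENNReal.ofReal_inv_of_pos (Nat.cast_pos.mpr (NeZero.pos n)), ENNReal.ofReal_natCast]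
    refine ⟨?_, (BoxIntegral.Box.measurableSet_coe _).preimage e.continuous.measurable, ?_⟩
    · rw [BoxIntegral.Box.coe_eq_pi]
      exact (convex_pi fun _ _ => convex_Ioc _ _).linear_preimage e.toLinearMap
    · refine (e.antilipschitz.ediam_preimage_le _).trans ?_
      refine (mul_le_mul_right hdiam _).trans ?_
      rw [← div_eq_mul_inv, ENNReal.div_le_iff (by simpa using NeZero.ne n) (by simp), mul_comm]
      exact hn.le

end Cells

section FormBound

theorem measure_ne_top_of_ediam_ne_top {X : Type*} [PseudoMetricSpace X] [ProperSpace X]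
    [MeasurableSpace X] {μ : Measure X} [IsFiniteMeasureOnCompacts μ] {s : Set X}
    (hs : Metric.ediam s ≠ ⊤) : μ s ≠ ⊤ :=
  (Metric.isBounded_iff_ediam_ne_top.mpr hs).measure_lt_top.ne

variable {u : L2} {G : Fin 3 → L2}

theorem HasWeakGradient.setLIntegral_sq_enorm_le (h : HasWeakGradient u G)
    {𝒬 : Finset (Set R3)} (hdisj : (𝒬 : Set (Set R3)).PairwiseDisjoint id) {d : ℝ≥0∞} (hd : d ≠ ⊤)
    (h𝒬 : ∀ Q ∈ 𝒬, Convex ℝ Q ∧ MeasurableSet Q ∧ Metric.ediam Q ≤ d)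
    (h0 : ∀ Q ∈ 𝒬, ∫ x in Q, u x = 0) :
    ∫⁻ x in ⋃ Q ∈ 𝒬, Q, ‖u x‖ₑ ^ 2 ≤ 2 ^ 3 * d ^ 2 * (2 * ∑ i, ‖G i‖ₑ ^ 2) := by
  have hfin (Q) (hQ : Q ∈ 𝒬) : volume Q ≠ ⊤ :=
    measure_ne_top_of_ediam_ne_top (ne_top_of_le_ne_top hd (h𝒬 Q hQ).2.2)
  obtain ⟨w, c, hlim, hc, hw⟩ := h.exists_hasCompactSupport_tendsto
  have hpair : ∀ᵐ p ∂cellPairMeasure volume 𝒬,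
      Tendsto (fun n => w n p.1 - w n p.2) atTop (𝓝 (u p.1 - u p.2)) := by
    refine (cellPairMeasure_absolutelyContinuous volume 𝒬).ae_le ?_
    filter_upwards [Measure.quasiMeasurePreserving_fst.ae hlim,
      Measure.quasiMeasurePreserving_snd.ae hlim] with p h₁ h₂ using h₁.sub h₂
  refine (setLIntegral_sq_enorm_le_cellPairMeasure hdisj
    (fun Q hQ => ⟨(h𝒬 Q hQ).2.1, hfin Q hQ⟩)
    (fun Q hQ => ?_) h0).trans
    (lintegral_sq_enorm_le_of_tendsto (fun n => ?_) hpair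
      (ENNReal.Tendsto.const_mul hc (Or.inr ?_)) fun n => ?_)
  · have : IsFiniteMeasure (volume.restrict Q) := ⟨by simpa using (hfin Q hQ).lt_top⟩
    exact ((Lp.memLp u).restrict Q).integrable one_le_two
  · have := (hw n).1.continuous
    exact Continuous.aestronglyMeasurable (by fun_prop)
  · exact ENNReal.mul_ne_top (by simp) (ENNReal.pow_ne_top hd)
  · obtain ⟨hwC, -, hwc⟩ := hw n
    have := lintegral_sq_enorm_sub_cellPairMeasure_le volume hdisj h𝒬 hwC
    rw [finrank_euclideanSpace_fin] at this
    refine this.trans ?_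
    gcongr

theorem HasWeakGradient.lintegral_enorm_mul_sq_enorm_le (h : HasWeakGradient u G) {U : R3 → ℝ}
    (hU : AEMeasurable U) (hfin : globalKatoNorm U ≠ ⊤) :
    ∫⁻ x, ‖U x‖ₑ * ‖u x‖ₑ ^ 2 ≤
      2 ^ 3 * ((volume : Measure R3).toSphere univ)⁻¹ * globalKatoNorm U *
        (2 * ∑ i, ‖G i‖ₑ ^ 2) := by
  have hdensity (f : R3 → ℝ≥0∞) :
      ∫⁻ x, f x ∂volume.withDensity (fun x => ‖U x‖ₑ) = ∫⁻ x, ‖U x‖ₑ * f x :=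
    lintegral_withDensity_eq_lintegral_mul_non_measurable₀ _ hU.enorm
      (.of_forall fun _ => enorm_lt_top) f
  rw [← hdensity]
  refine h.lintegral_sq_enorm_le (withDensity_absolutelyContinuous _ _) hfin fun x => ?_
  simp only [hdensity, rieszKernel, pow_one]
  exact le_iSup (fun x : R3 => ∫⁻ y : R3, ‖U y‖ₑ / ‖x - y‖ₑ) x

theorem IsBoundedCompactlySupported.exists_form_bound {W : R3 → ℝ}
    (hW : IsBoundedCompactlySupported W) {ε : ℝ≥0∞} (hε : ε ≠ 0) :
    ∃ 𝒬 : Finset (Set R3), (∀ Q ∈ 𝒬, MeasurableSet Q ∧ volume Q ≠ ⊤) ∧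
      ∀ (u : L2) (G : Fin 3 → L2), HasWeakGradient u G → (∀ Q ∈ 𝒬, ∫ x in Q, u x = 0) →
        ∫⁻ x, ‖W x‖ₑ * ‖u x‖ₑ ^ 2 ≤ ε * ∑ i, ‖G i‖ₑ ^ 2 := by
  obtain ⟨-, ⟨B, hB⟩, hsupp⟩ := hW
  have hWB (x : R3) : ‖W x‖ₑ ≤ ENNReal.ofReal B := by
    rw [← ofReal_norm]
    exact ENNReal.ofReal_le_ofReal (hB x)
  obtain ⟨d, hd, hdε⟩ : ∃ d : NNReal, 0 < d ∧ ENNReal.ofReal B * (2 ^ 3 * d ^ 2 * 2) ≤ ε := by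
    obtain ⟨t, ht, htε⟩ := ENNReal.exists_nnreal_pos_mul_lt
      (a := ENNReal.ofReal B * (2 ^ 3 * 2)) (by finiteness) hε
    refine ⟨NNReal.sqrt t, NNReal.sqrt_pos.mpr ht, htε.le.trans_eq' ?_⟩
    rw [← ENNReal.coe_pow, NNReal.sq_sqrt]
    ring
  obtain ⟨𝒬, hcover, hdisj, h𝒬⟩ := exists_finset_convex_cover hsupp.isCompact.isBounded
    (ENNReal.coe_ne_zero.mpr hd.ne')
  refine ⟨𝒬, fun Q hQ => ⟨(h𝒬 Q hQ).2.1, measure_ne_top_of_ediam_ne_top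
    (ne_top_of_le_ne_top ENNReal.coe_ne_top (h𝒬 Q hQ).2.2)⟩, fun u G h h0 => ?_⟩
  calc ∫⁻ x, ‖W x‖ₑ * ‖u x‖ₑ ^ 2 = ∫⁻ x in ⋃ Q ∈ 𝒬, Q, ‖W x‖ₑ * ‖u x‖ₑ ^ 2 := by
        refine (setLIntegral_eq_of_support_subset fun x hx =>
          hcover (subset_tsupport W fun hWx => hx ?_)).symm
        simp [hWx]
    _ ≤ ENNReal.ofReal B * ∫⁻ x in ⋃ Q ∈ 𝒬, Q, ‖u x‖ₑ ^ 2 := by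
        rw [← lintegral_const_mul' _ _ ENNReal.ofReal_ne_top]
        gcongr with x
        exact hWB x
    _ ≤ ENNReal.ofReal B * (2 ^ 3 * d ^ 2 * (2 * ∑ i, ‖G i‖ₑ ^ 2)) := by
        gcongr
        exact h.setLIntegral_sq_enorm_le hdisj ENNReal.coe_ne_top h𝒬 h0
    _ = ENNReal.ofReal B * (2 ^ 3 * d ^ 2 * 2) * ∑ i, ‖G i‖ₑ ^ 2 := by ring
    _ ≤ ε * ∑ i, ‖G i‖ₑ ^ 2 := by gcongr

theorem MemKatoZero.exists_form_bound {V : R3 → ℝ} (hV : MemKatoZero V) {ε : ℝ≥0∞}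
    (hε : ε ≠ 0) :
    ∃ 𝒬 : Finset (Set R3), (∀ Q ∈ 𝒬, MeasurableSet Q ∧ volume Q ≠ ⊤) ∧
      ∀ (u : L2) (G : Fin 3 → L2), HasWeakGradient u G → (∀ Q ∈ 𝒬, ∫ x in Q, u x = 0) →
        ∫⁻ x, ‖V x‖ₑ * ‖u x‖ₑ ^ 2 ≤ ε * ∑ i, ‖G i‖ₑ ^ 2 := by
  have hσ : 2 ^ 3 * ((volume : Measure R3).toSphere univ)⁻¹ * 2 ≠ ⊤ := by
    have : (volume : Measure R3).toSphere univ ≠ 0 :=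
      Measure.measure_univ_ne_zero.mpr (Measure.toSphere_ne_zero _)
    finiteness
  obtain ⟨δ, hδ, hδε⟩ := ENNReal.exists_nnreal_pos_mul_lt hσ (ENNReal.half_pos hε).ne'
  obtain ⟨W, hW, hVW⟩ := hV.2 δ (by simpa using hδ)
  obtain ⟨𝒬, h𝒬, hform⟩ := hW.exists_form_bound (ENNReal.half_pos hε).ne'
  refine ⟨𝒬, h𝒬, fun u G h h0 => ?_⟩
  have hsmall : ∫⁻ x, ‖(V - W) x‖ₑ * ‖u x‖ₑ ^ 2 ≤ ε / 2 * ∑ i, ‖G i‖ₑ ^ 2 := by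
    calc ∫⁻ x, ‖(V - W) x‖ₑ * ‖u x‖ₑ ^ 2
        ≤ 2 ^ 3 * ((volume : Measure R3).toSphere univ)⁻¹ * globalKatoNorm (V - W) *
            (2 * ∑ i, ‖G i‖ₑ ^ 2) :=
          h.lintegral_enorm_mul_sq_enorm_le (hV.1.sub hW.1) hVW.ne_top
      _ ≤ 2 ^ 3 * ((volume : Measure R3).toSphere univ)⁻¹ * δ * (2 * ∑ i, ‖G i‖ₑ ^ 2) := by
          gcongr
      _ = δ * (2 ^ 3 * ((volume : Measure R3).toSphere univ)⁻¹ * 2) * ∑ i, ‖G i‖ₑ ^ 2 := by ring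
      _ ≤ ε / 2 * ∑ i, ‖G i‖ₑ ^ 2 := by gcongr
  calc ∫⁻ x, ‖V x‖ₑ * ‖u x‖ₑ ^ 2
      ≤ ∫⁻ x, (‖(V - W) x‖ₑ * ‖u x‖ₑ ^ 2 + ‖W x‖ₑ * ‖u x‖ₑ ^ 2) := by
        gcongr with x
        rw [← add_mul]
        gcongr
        simpa using enorm_add_le ((V - W) x) (W x)
    _ = (∫⁻ x, ‖(V - W) x‖ₑ * ‖u x‖ₑ ^ 2) + ∫⁻ x, ‖W x‖ₑ * ‖u x‖ₑ ^ 2 :=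
        lintegral_add_right' _ (hW.1.enorm.mul
          ((Lp.stronglyMeasurable u).enorm.pow_const 2).aemeasurable)
    _ ≤ ε / 2 * ∑ i, ‖G i‖ₑ ^ 2 + ε / 2 * ∑ i, ‖G i‖ₑ ^ 2 := add_le_add hsmall (hform u G h h0)
    _ = ε * ∑ i, ‖G i‖ₑ ^ 2 := by rw [← add_mul, ENNReal.add_halves]

end FormBound

section NegativeEigenvectors

variable {𝕜 H : Type*} [RCLike 𝕜] [NormedAddCommGroup H] [InnerProductSpace 𝕜 H] {T : H →ₗ.[𝕜] H}

theorem inner_eq_zero_of_apply_eq_smul (hT : T.IsFormalAdjoint T) {l m : ℝ} (hlm : l ≠ m)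
    {ψ φ : T.domain} (hψ : T ψ = (l : 𝕜) • (ψ : H)) (hφ : T φ = (m : 𝕜) • (φ : H)) :
    ⟪(ψ : H), (φ : H)⟫_𝕜 = 0 := by
  have h := hT ψ φ
  rw [hψ, hφ, inner_smul_left, inner_smul_right, RCLike.conj_ofReal] at h
  exact (mul_eq_mul_right_iff.mp h).resolve_left (RCLike.ofReal_injective.ne hlm)

theorem re_inner_sum_eigenvectors (hT : T.IsFormalAdjoint T) {t : Finset ℝ} {ψ : ℝ → T.domain}
    (hψ : ∀ l ∈ t, T (ψ l) = (l : 𝕜) • (ψ l : H)) :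
    RCLike.re ⟪((∑ l ∈ t, ψ l : T.domain) : H), T (∑ l ∈ t, ψ l)⟫_𝕜 =
      ∑ l ∈ t, l * ‖(ψ l : H)‖ ^ 2 := by
  have hTsum : T (∑ l ∈ t, ψ l) = ∑ l ∈ t, (l : 𝕜) • (ψ l : H) :=
    (map_sum T.toFun ψ t).trans (Finset.sum_congr rfl hψ)
  rw [hTsum, AddSubmonoidClass.coe_finsetSum, sum_inner, map_sum]
  refine Finset.sum_congr rfl fun l hl => ?_
  rw [inner_sum, Finset.sum_eq_single_of_mem l hl fun m hm hml => ?_]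
  · rw [inner_smul_right, RCLike.re_ofReal_mul, inner_self_eq_norm_sq]
  · rw [inner_smul_right, inner_eq_zero_of_apply_eq_smul hT hml.symm (hψ l hl) (hψ m hm),
      mul_zero]

theorem eigenvectors_eq_zero_of_re_inner_nonneg (hT : T.IsFormalAdjoint T) {t : Finset ℝ}
    (ht : ∀ l ∈ t, l < 0) {ψ : ℝ → T.domain} (hψ : ∀ l ∈ t, T (ψ l) = (l : 𝕜) • (ψ l : H))
    (h : 0 ≤ RCLike.re ⟪((∑ l ∈ t, ψ l : T.domain) : H), T (∑ l ∈ t, ψ l)⟫_𝕜) :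
    ∀ l ∈ t, ψ l = 0 := by
  rw [re_inner_sum_eigenvectors hT hψ] at h
  have hterm (l) (hl : l ∈ t) : l * ‖(ψ l : H)‖ ^ 2 ≤ 0 :=
    mul_nonpos_of_nonpos_of_nonneg (ht l hl).le (sq_nonneg _)
  intro l hl
  have hl0 := (Finset.sum_eq_zero_iff_of_nonpos hterm).mp
    ((Finset.sum_nonpos hterm).antisymm h) l hl
  simpa [(ht l hl).ne] using hl0

end NegativeEigenvectors

section Eigenvalues

variable {T : L2 →ₗ.[ℂ] L2} {F : Type*} [AddCommGroup F] [Module ℂ F] [FiniteDimensional ℂ F]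
  {A : L2 →ₗ[ℂ] F}

theorem mem_eigenspace_iff {μ : ℂ} {ψ : T.domain} : ψ ∈ eigenspace T μ ↔ T ψ = μ • (ψ : L2) := by
  rw [eigenspace, LinearMap.mem_ker, LinearMap.sub_apply, sub_eq_zero]
  rfl

theorem finite_setOf_neg_isEigenvalue (hT : T.IsFormalAdjoint T)
    (hA : ∀ u : T.domain, A u = 0 → 0 ≤ (⟪(u : L2), T u⟫_ℂ).re) :
    {l : ℝ | l < 0 ∧ IsEigenvalue T l}.Finite := by
  have hex (l : ℝ) (hl : l ∈ {l : ℝ | l < 0 ∧ IsEigenvalue T l}) :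
      ∃ ψ ∈ eigenspace T l, ψ ≠ 0 := Submodule.exists_mem_ne_zero_of_ne_bot hl.2
  choose! ψ hψ hψ0 using hex
  suffices hli : LinearIndepOn ℂ (fun l => A (ψ l)) {l : ℝ | l < 0 ∧ IsEigenvalue T l} from
    Set.finite_coe_iff.mp (LinearIndependent.finite hli)
  refine linearIndepOn_iff'.mpr fun t c ht hc l hl => ?_
  have hker : A ((∑ l ∈ t, c l • ψ l : T.domain) : L2) = 0 := by simpa using hc
  have hzero := eigenvectors_eq_zero_of_re_inner_nonneg hT (fun l hl => (ht hl).1)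
    (fun l hl =>
    mem_eigenspace_iff.mp ((eigenspace T l).smul_mem (c l) (hψ l (ht hl)))) (hA _ hker) l hl
  exact (smul_eq_zero.mp hzero).resolve_right (hψ0 l (ht hl))

theorem finiteDimensional_eigenspace_of_neg (hT : T.IsFormalAdjoint T)
    (hA : ∀ u : T.domain, A u = 0 → 0 ≤ (⟪(u : L2), T u⟫_ℂ).re) {l : ℝ} (hl : l < 0) :
    FiniteDimensional ℂ (eigenspace T l) := by
  refine FiniteDimensional.of_injective
    (A ∘ₗ T.domain.subtype ∘ₗ (eigenspace T l).subtype) ?_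
  rw [← LinearMap.ker_eq_bot, LinearMap.ker_eq_bot']
  intro ψ hψ
  have hzero := eigenvectors_eq_zero_of_re_inner_nonneg hT (t := {l}) (by simpa using hl)
    (ψ := fun _ => ψ) (by simpa using mem_eigenspace_iff.mp ψ.2) (by simpa using hA ψ hψ) l
    (Finset.mem_singleton_self l)
  exact Subtype.ext hzero

end Eigenvalues

section SchrodingerOperator

variable {V : R3 → ℝ} {u v f g : L2}

theorem SchrodingerEq.inner_comm (hu : SchrodingerEq V u f) (hv : SchrodingerEq V v g) :
    ⟪f, v⟫_ℂ = ⟪u, g⟫_ℂ := by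
  obtain ⟨G, hG, hf⟩ := hu
  obtain ⟨K, hK, hg⟩ := hv
  obtain ⟨-, hvf⟩ := hf v K hK
  obtain ⟨-, hug⟩ := hg u G hG
  rw [← inner_conj_symm f v, ← hvf, ← hug, map_add, map_sum, ← integral_conj]
  simp only [inner_conj_symm, map_mul, Complex.conj_ofReal, Complex.conj_conj, mul_assoc,
    mul_comm (starRingEnd ℂ _)]

theorem isFormalAdjoint_schrodingerOperator (V : R3 → ℝ) :
    (schrodingerOperator V).IsFormalAdjoint (schrodingerOperator V) := fun ψ φ =>
  SchrodingerEq.inner_comm ((mem_graph_schrodingerOperator V _ _).mp (LinearPMap.mem_graph _ ψ))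
    ((mem_graph_schrodingerOperator V _ _).mp (LinearPMap.mem_graph _ φ))

theorem SchrodingerEq.re_inner_nonneg (h : SchrodingerEq V u f)
    (hV : ∀ G, HasWeakGradient u G → ∫⁻ x, ‖V x‖ₑ * ‖u x‖ₑ ^ 2 ≤ ∑ i, ‖G i‖ₑ ^ 2) :
    0 ≤ (⟪u, f⟫_ℂ).re := by
  obtain ⟨G, hG, h⟩ := h
  obtain ⟨-, hform⟩ := h u G hG
  have hkinetic (i) : (⟪G i, G i⟫_ℂ).re = ‖G i‖ ^ 2 := inner_self_eq_norm_sq (𝕜 := ℂ) (G i)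
  have henorm (x) : ‖(V x : ℂ)‖ₑ = ‖V x‖ₑ := by
    rw [← ofReal_norm, Complex.norm_real, ofReal_norm]
  have hpotential :
      ‖∫ x, (V x : ℂ) * u x * starRingEnd ℂ (u x)‖ ≤ ∑ i, ‖G i‖ ^ 2 := by
    rw [← ENNReal.ofReal_le_ofReal_iff (by positivity), ofReal_norm,
      ENNReal.ofReal_sum_of_nonneg fun i _ => by positivity]
    calc ‖∫ x, (V x : ℂ) * u x * starRingEnd ℂ (u x)‖ₑ
        ≤ ∫⁻ x, ‖(V x : ℂ) * u x * starRingEnd ℂ (u x)‖ₑ := enorm_integral_le_lintegral_enorm _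
      _ = ∫⁻ x, ‖V x‖ₑ * ‖u x‖ₑ ^ 2 := by
        simp only [enorm_mul, henorm, RCLike.enorm_conj, sq, mul_assoc]
      _ ≤ ∑ i, ‖G i‖ₑ ^ 2 := hV G hG
      _ = ∑ i, ENNReal.ofReal (‖G i‖ ^ 2) := by
        simp only [ENNReal.ofReal_pow (norm_nonneg _), ofReal_norm]
  rw [← hform, Complex.add_re, Complex.re_sum]
  simp only [hkinetic]
  linarith [(abs_le.mp ((Complex.abs_re_le_norm _).trans hpotential)).1]

/-- The map `u ↦ (∫_Q u)_Q` for finitely many sets `Q` of finite measure. -/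
noncomputable def cellIntegrals (𝒬 : Finset (Set R3))
    (h𝒬 : ∀ Q ∈ 𝒬, MeasurableSet Q ∧ volume Q ≠ ⊤) : L2 →ₗ[ℂ] (𝒬 → ℂ) :=
  LinearMap.pi fun Q =>
    (innerSL ℂ (indicatorConstLp 2 (h𝒬 Q Q.2).1 (h𝒬 Q Q.2).2 (1 : ℂ))).toLinearMap

theorem cellIntegrals_apply {𝒬 : Finset (Set R3)}
    (h𝒬 : ∀ Q ∈ 𝒬, MeasurableSet Q ∧ volume Q ≠ ⊤) (u : L2) (Q : 𝒬) :
    cellIntegrals 𝒬 h𝒬 u Q = ∫ x in (Q : Set R3), u x :=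
  L2.inner_indicatorConstLp_one (𝕜 := ℂ) (h𝒬 Q Q.2).1 (h𝒬 Q Q.2).2 u

theorem MemKatoZero.exists_re_inner_nonneg (hV : MemKatoZero V) :
    ∃ (𝒬 : Finset (Set R3)) (A : L2 →ₗ[ℂ] (𝒬 → ℂ)), ∀ u : (schrodingerOperator V).domain,
      A u = 0 → 0 ≤ (⟪(u : L2), schrodingerOperator V u⟫_ℂ).re := by
  obtain ⟨𝒬, h𝒬, hform⟩ := hV.exists_form_bound one_ne_zero
  refine ⟨𝒬, cellIntegrals 𝒬 h𝒬, fun u hu => ?_⟩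
  have hu0 (Q) (hQ : Q ∈ 𝒬) : ∫ x in Q, (u : L2) x = 0 :=
    (cellIntegrals_apply h𝒬 u ⟨Q, hQ⟩).symm.trans (congrFun hu _)
  have heq := (mem_graph_schrodingerOperator V _ _).mp (LinearPMap.mem_graph _ u)
  exact heq.re_inner_nonneg fun G hG => by simpa using hform u G hG hu0

end SchrodingerOperator

end SchrodingerKato

theorem lemma2p6_general (V : SchrodingerKato.R3 → ℝ) (hV : SchrodingerKato.MemKatoZero V) :
    {l : ℝ | l < 0 ∧
        SchrodingerKato.IsEigenvalue (SchrodingerKato.schrodingerOperator V) (l : ℂ)}.Finite ∧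
      ∀ l : ℝ, l < 0 →
        FiniteDimensional ℂ
          (SchrodingerKato.eigenspace (SchrodingerKato.schrodingerOperator V) (l : ℂ)) := by
  obtain ⟨𝒬, A, hA⟩ := hV.exists_re_inner_nonneg
  have hsymm := SchrodingerKato.isFormalAdjoint_schrodingerOperator V
  exact ⟨SchrodingerKato.finite_setOf_neg_isEigenvalue hsymm hA,
    fun l hl => SchrodingerKato.finiteDimensional_eigenspace_of_neg hsymm hA hl⟩

theorem lemma2p6 (V : SchrodingerKato.R3 → ℝ)
    (hV : SchrodingerKato.MemKatoZero V)
    (h0 : ¬ SchrodingerKato.IsResonance V 0) :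
    {l : ℝ | l < 0 ∧
        SchrodingerKato.IsEigenvalue (SchrodingerKato.schrodingerOperator V) (l : ℂ)}.Finite ∧
      ∀ l : ℝ, l < 0 →
        FiniteDimensional ℂ
          (SchrodingerKato.eigenspace (SchrodingerKato.schrodingerOperator V) (l : ℂ)) :=
  lemma2p6_general V hV
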